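/- \textbf{Setting.} Let $q\in(3,\infty]$, let $T>0$, and let $U_0=U_0(y,s):\mathbb R^3\times\mathbb R\to\mathbb R^3$ be $C^1$ in $(y,s)$, $T$-periodic in $s$, and divergence free in $y$, such that: (a) $LU_0=0$, where $LW=\partial_sW-\Delta W-W-y\cdot\nabla W$. For a $C^1$ field this is understood weakly: for every time $s$ and every $\zeta\in C^1_c(\mathbb R^3;\mathbb R^3)$ one has $\langle LU_0(s),\zeta\rangle=0$, where $$\langle LW(s),\zeta\rangle=\int_{\mathbb R^3}(\partial_sW-W-y\cdot\nabla W)\cdot\zeta\,dy+\int_{\mathbb R^3}\nabla W:\nabla\zeta\,dy ;$$ (b) $U_0\in L^\infty(0,T;L^4\cap L^q(\mathbb R^3))$ and $\partial_sU_0\in L^\infty(0,T;L^{6/5}_{loc}(\mathbb R^3))$; (c) there is $\Theta:[0,\infty)\to[0,\infty)$ with $\Theta(R)\to0$ as $R\to\infty$ and $\sup_{s\in[0,T]}\|U_0(\cdot,s)\|_{L^q(\mathbb R^3\setminus B_R)}\le\Theta(R)$ for all $R\ge0$, where $B_R$ is the ball of radius $R$ centred at $0$. Let $Z\in C^\infty(\mathbb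 R^3)$ with $0\le Z\le1$, $Z(x)=1$ for $|x|>2$ and $Z(x)=0$ for $|x|<1$. \textbf{Claim.} There is a function $R\mapsto c(R)=c(R,U_0)\in[0,\infty)$, not depending on $\alpha$ (but possibly depending on the data $q,T,U_0,Z$), such that for every $\alpha\in(0,1)$ there exists $R_0\ge1$ for which, with $\xi(y)=Z(y/R_0)$, $$W(y,s)=\xi(y)U_0(y,s)+w(y,s),\qquad w(y,s)=\int_{\mathbb R^3}\nabla_y\frac1{4\pi|y-z|}\,\bigl(\nabla\xi(z)\cdot U_0(z,s)\bigr)\,dz$$ (the integral converging absolutely for all $(y,s)$), the following hold: (i) $W$ is $C^1$ in $(y,s)\in\mathbb R^3\times\mathbb R$, $T$-periodic in $s$, and divergence free in $y$; (ii) $U_0-W\in L^\infty(0,T;L^2(\mathbb R^3))$; (iii) $\|W\|_{L^\infty(0,T;L^q(\mathbb R^3))}\le\alpha$; (iv) $\|W\|_{L^\infty(0,T;L^4(\mathbb R^3))}\le c(R_0)$; (v) $\|LW\|_{L^\infty(0,T;H^{-1}(\mathbb R^3))}\le c(R_0)$, where $LW(s)$ is given by the pairing above and $H^{-1}(\mathbb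 R^3)$ is the dual of $H^1(\mathbb R^3;\mathbb R^3)$. -/

import Mathlib

open MeasureTheory Filter Topology
open scoped ENNReal NNReal ContDiff

noncomputable section

namespace Leray

/-- Three-dimensional Euclidean space. -/
abbrev E3 : Type := EuclideanSpace ℝ (Fin 3)

/-- The `i`-th standard basis vector. -/
def basisVec (i : Fin 3) : E3 := EuclideanSpace.single i 1

/-- Partial derivative `∂ᵢ f (y)` of a vector field on `ℝ³`. -/
def partialDeriv (i : Fin 3) (f : E3 → E3) (y : E3) : E3 := fderiv ℝ f y (basisVec i)

/-- Divergence `∑ᵢ ∂ᵢ fᵢ (y)` of a vector field on `ℝ³`. -/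
def divergence (f : E3 → E3) (y : E3) : ℝ := ∑ i : Fin 3, partialDeriv i f y i

/-- Time derivative `∂ₛ W (y, s)`. -/
def timeDeriv (W : E3 → ℝ → E3) (y : E3) (s : ℝ) : E3 := deriv (fun t => W y t) s

/-- The norm of `L^∞(0,T; L^p(μ))`, for a measure `μ` on `ℝ³`. -/
def linftyLpNorm (f : E3 → ℝ → E3) (p : ℝ≥0∞) (T : ℝ) (μ : Measure E3) : ℝ≥0∞ :=
  essSup (fun s => eLpNorm (fun y => f y s) p μ) (volume.restrict (Set.Ioo 0 T))

/-- Membership in `L^∞(0,T; L^p(μ))`. -/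
def MemLinftyLp (f : E3 → ℝ → E3) (p : ℝ≥0∞) (T : ℝ) (μ : Measure E3) : Prop :=
  AEStronglyMeasurable (Function.uncurry f) (μ.prod (volume.restrict (Set.Ioo 0 T))) ∧
    linftyLpNorm f p T μ < ⊤

/-- Test fields `ζ ∈ C¹₀(ℝ³; ℝ³)`. -/
def IsTestField (ζ : E3 → E3) : Prop := ContDiff ℝ 1 ζ ∧ HasCompactSupport ζ

/-- The pairing `⟨LW(s), ζ⟩ = (∂ₛW - W - y·∇W, ζ) + (∇W, ∇ζ)`, which is the weak form of
`LW = ∂ₛW - ΔW - W - y·∇W` at time `s`. -/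
def pairingL (W : E3 → ℝ → E3) (s : ℝ) (ζ : E3 → E3) : ℝ :=
  (∫ y, inner ℝ (timeDeriv W y s - W y s - fderiv ℝ (fun x => W x s) y y) (ζ y)) +
    ∫ y, ∑ i : Fin 3, inner ℝ (partialDeriv i (fun x => W x s) y) (partialDeriv i ζ y)

/-- The squared `H¹(ℝ³)` norm of a test field. -/
def sqNormH1 (ζ : E3 → E3) : ℝ :=
  (∫ y, ‖ζ y‖ ^ 2) + ∫ y, ∑ i : Fin 3, ‖partialDeriv i ζ y‖ ^ 2

/-- The norm of `ℓ` in `H⁻¹(ℝ³)`, the dual of `H¹₀(ℝ³) = H¹(ℝ³)`, for a linear functional `ℓ`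
given on the test fields. These are dense in `H¹(ℝ³)`, so `ℓ` extends (uniquely) to an element of
`H⁻¹(ℝ³)` exactly when this supremum is finite, and then it is the norm of that element. -/
def normHNegOne (ℓ : (E3 → E3) → ℝ) : ℝ≥0∞ :=
  ⨆ (ζ : E3 → E3) (_ : IsTestField ζ ∧ sqNormH1 ζ ≤ 1), ENNReal.ofReal |ℓ ζ|

/-- The norm of `LW` in `L^∞(0,T; H⁻¹(ℝ³))`. -/
def linftyHNegOneNormL (W : E3 → ℝ → E3) (T : ℝ) : ℝ≥0∞ :=
  essSup (fun s => normHNegOne (pairingL W s)) (volume.restrict (Set.Ioo 0 T))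

/-- The standing assumption on the boundary profile `U₀(y, s)`, with period `T` and exponent `q`.
A `C¹` field need not have a classical Laplacian, so `L U₀ = 0` is required in the weak sense. -/
structure IsProfile (T : ℝ) (q : ℝ≥0∞) (U₀ : E3 → ℝ → E3) : Prop where
  contDiff : ContDiff ℝ 1 (Function.uncurry U₀)
  period_pos : 0 < T
  periodic : ∀ y s, U₀ y (s + T) = U₀ y s
  divFree : ∀ y s, divergence (fun x => U₀ x s) y = 0
  equation : ∀ s ζ, IsTestField ζ → pairingL U₀ s ζ = 0
  memL4 : MemLinftyLp U₀ 4 T volume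
  memLq : MemLinftyLp U₀ q T volume
  timeDeriv_mem : ∀ K : Set E3, IsCompact K →
    MemLinftyLp (timeDeriv U₀) (6 / 5) T (volume.restrict K)
  decay : ∃ Θ : ℝ≥0 → ℝ≥0, Tendsto Θ atTop (𝓝 0) ∧
    ∀ R : ℝ≥0, ∀ s ∈ Set.Icc (0 : ℝ) T,
      eLpNorm (fun y => U₀ y s) q (volume.restrict (Metric.ball (0 : E3) R)ᶜ) ≤ Θ R

/-- The fixed smooth cutoff function `Z`. -/
structure IsCutoff (Z : E3 → ℝ) : Prop where
  smooth : ContDiff ℝ ∞ Z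
  nonneg : ∀ x, 0 ≤ Z x
  le_one : ∀ x, Z x ≤ 1
  eq_one : ∀ x, 2 < ‖x‖ → Z x = 1
  eq_zero : ∀ x, ‖x‖ < 1 → Z x = 0

/-- The rescaled cutoff `ξ(y) = Z(y / R)`. -/
def rescaledCutoff (Z : E3 → ℝ) (R : ℝ) (y : E3) : ℝ := Z (R⁻¹ • y)

/-- The integrand `∇_y (1 / (4π|y - z|)) (∇ξ(z) · U₀(z, s))`, as a function of `z`. -/
def correctionIntegrand (Z : E3 → ℝ) (R : ℝ) (U₀ : E3 → ℝ → E3) (y : E3) (s : ℝ) (z : E3) : E3 :=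
  inner ℝ (gradient (rescaledCutoff Z R) z) (U₀ z s) •
    gradient (fun x : E3 => 1 / (4 * Real.pi * ‖x - z‖)) y

/-- The correction `w(y, s) = ∫ ∇_y (1 / (4π|y - z|)) (∇ξ(z) · U₀(z, s)) dz`. -/
def correction (Z : E3 → ℝ) (R : ℝ) (U₀ : E3 → ℝ → E3) (y : E3) (s : ℝ) : E3 :=
  ∫ z, correctionIntegrand Z R U₀ y s z

/-- The revised profile `W = ξ U₀ + w`. -/
def revisedProfile (Z : E3 → ℝ) (R : ℝ) (U₀ : E3 → ℝ → E3) (y : E3) (s : ℝ) : E3 :=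
  rescaledCutoff Z R y • U₀ y s + correction Z R U₀ y s

end Leray

end

/-! Let `K` be the gradient of `1 / (4π|x|)`. The correction is the convolution `w = K * g` with `g
= ∇ξ · U₀`. Since `div K = -δ`, one has `div w = -g`, which cancels the term `∇ξ · U₀` in `div (ξ
U₀)`; the identity `div K = -δ` is `integral_fderiv_newtonKernel`, proved in polar coordinates.

The smallness in `L^q` must be uniform in `R`, and this comes from scaling. `K` is homogeneous of
degree `-2` and `∇ξ` scales like `R⁻¹`, so dilation by `R` reduces the bound to a density supported
in the fixed annulus `1 ≤ |z| ≤ 2`. There Hölder's inequality gives decay `(1 + |y|)⁻²`: the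
singularity `|x|⁻²` is locally in the dual space of `L^q` because `q > 3`, and the decay rate itself
is in `L^q`. Hence `‖W(s)‖_q ≤ C ‖U₀(s)‖_{L^q(|y| ≥ R)} ≤ C Θ(R)` with `C` independent of `R`, and a
large `R₀` makes this at most `α`.

The remaining bounds may depend on `R`. Being the field of a `C¹` density of compact support, `w` is
`O((1 + |y|)⁻²)`, and so are `∂ₛw`, `∇w` and `y · ∇w`; the last costs no power of `|y|`, because a
radial derivative of `w` can be moved onto `g` by a dilation. This rate lies in `L²` and `L⁴`. For
`LW`, the equation of `U₀` tested with `ξζ` is subtracted from the pairing of `LW` with `ζ`. What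
survives is the pairing of `Lw` and commutators of `L` with `ξ`, which vanish for `|y| > 2R`. All of
it is dominated by the decay rate, hence bounded on `H¹`. -/

namespace Leray

/-! ### The Newtonian kernel and its fundamental-solution property -/

/-- The gradient of the Newtonian potential `1 / (4π‖x‖)` on `ℝ³`. -/
noncomputable def newtonKernel (x : E3) : E3 := (-(4 * Real.pi * ‖x‖ ^ 3)⁻¹) • x

lemma norm_newtonKernel (x : E3) : ‖newtonKernel x‖ = (4 * Real.pi)⁻¹ * (‖x‖ ^ 2)⁻¹ := by
  have := Real.pi_pos
  rcases eq_or_ne x 0 with rfl | hx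
  · simp [newtonKernel]
  have hx' : 0 < ‖x‖ := norm_pos_iff.2 hx
  rw [newtonKernel, norm_smul, norm_neg, norm_inv, Real.norm_of_nonneg (by positivity)]
  field_simp

lemma newtonKernel_smul {c : ℝ} (hc : 0 < c) (x : E3) :
    newtonKernel (c • x) = (c ^ 2)⁻¹ • newtonKernel x := by
  have := Real.pi_pos
  rcases eq_or_ne x 0 with rfl | hx
  · simp [newtonKernel]
  have hx' : 0 < ‖x‖ := norm_pos_iff.2 hx
  simp only [newtonKernel, norm_smul, Real.norm_of_nonneg hc.le, smul_smul]
  congr 1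
  field_simp

lemma measurable_newtonKernel : Measurable newtonKernel := by
  unfold newtonKernel
  fun_prop

lemma gradient_newtonPotential {y z : E3} (h : y ≠ z) :
    gradient (fun x : E3 => 1 / (4 * Real.pi * ‖x - z‖)) y = newtonKernel (y - z) := by
  have hpi := Real.pi_pos
  have hx' : 0 < ‖y - z‖ := norm_pos_iff.2 (sub_ne_zero.2 h)
  apply HasGradientAt.gradient
  rw [hasGradientAt_iff_hasFDerivAt]
  have h1 : HasFDerivAt (fun x : E3 => ‖x - z‖ ^ 2) (2 • (innerSL ℝ (y - z))) y := by
    simpa using ((hasFDerivAt_id y).sub_const z).norm_sq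
  have h2 : HasFDerivAt (fun x : E3 => ‖x - z‖) ((‖y - z‖)⁻¹ • innerSL ℝ (y - z)) y := by
    have := h1.sqrt (by positivity)
    simp only [Real.sqrt_sq (norm_nonneg _)] at this
    refine this.congr_fderiv ?_
    ext v
    simp
    field_simp
  have h3 := (hasDerivAt_inv (by positivity : 4 * Real.pi * ‖y - z‖ ≠ 0)).comp_hasFDerivAt y
    (h2.const_mul (4 * Real.pi))
  simp only [one_div]
  refine h3.congr_fderiv ?_
  ext v
  simp [newtonKernel]
  field_simp

/-- In polar coordinates the `p`-th power of the kernel is a multiple of `r ^ (2 - 2p)`, integrable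
at the origin when `p < 3/2`. -/
lemma memLp_newtonKernel {p : ℝ≥0∞} (hp : p < 3 / 2) (ρ : ℝ) :
    MemLp newtonKernel p (volume.restrict (Metric.ball 0 ρ)) := by
  rcases eq_or_ne p 0 with rfl | hp0
  · exact memLp_zero_iff_aestronglyMeasurable.2 measurable_newtonKernel.aestronglyMeasurable
  have hpt : p ≠ ⊤ := ne_top_of_lt hp
  have hr : p.toReal < 3 / 2 := by
    have := (ENNReal.toReal_lt_toReal hpt (by finiteness)).2 hp
    simpa using this
  have hr0 : 0 < p.toReal := ENNReal.toReal_pos hp0 hpt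
  rw [← integrable_norm_rpow_iff measurable_newtonKernel.aestronglyMeasurable hp0 hpt]
  simp only [norm_newtonKernel]
  refine (integrableOn_fun_norm_addHaar (E := E3) volume
    (f := fun r => ((4 * Real.pi)⁻¹ * (r ^ 2)⁻¹) ^ p.toReal)).2 ?_
  rcases le_or_gt ρ 0 with hρ | hρ
  · simp [Set.Ioo_eq_empty (not_lt.2 hρ)]
  have h1 : IntervalIntegrable (fun r : ℝ => (4 * Real.pi)⁻¹ ^ p.toReal * r ^ (2 - 2 * p.toReal))
      volume 0 ρ :=
    (intervalIntegral.intervalIntegrable_rpow' (by linarith)).const_mul _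
  rw [intervalIntegrable_iff_integrableOn_Ioo_of_le hρ.le] at h1
  refine h1.congr_fun (fun r hr => ?_) measurableSet_Ioo
  have hr0 : 0 < r := hr.1
  simp only [finrank_euclideanSpace, Fintype.card_fin, smul_eq_mul]
  rw [Real.mul_rpow (by positivity) (by positivity), Real.inv_rpow (by positivity) (p.toReal),
    ← Real.rpow_natCast r 2, Real.inv_rpow (by positivity),
    ← Real.rpow_mul hr0.le, Real.rpow_sub hr0]
  norm_num
  field_simp

lemma locallyIntegrable_newtonKernel : LocallyIntegrable newtonKernel := by
  intro x
  refine ⟨Metric.ball 0 (‖x‖ + 1), Metric.isOpen_ball.mem_nhds (by simp), ?_⟩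
  exact memLp_one_iff_integrable.1 (memLp_newtonKernel
    (by rw [ENNReal.lt_div_iff_mul_lt (by simp) (by simp)]; norm_num) _)

/-- Up to sign this is the existence at `0` of the convolution of a continuous compactly supported
function with a locally integrable one; the sign comes from the oddness of the kernel. -/
lemma integrable_fderiv_newtonKernel {φ : E3 → ℝ} (hφ : ContDiff ℝ 1 φ) (hc : HasCompactSupport φ) :
    Integrable (fun x => fderiv ℝ φ x (newtonKernel x)) := by
  have h := (hc.fderiv ℝ).convolutionExists_left (μ := volume)
    (ContinuousLinearMap.id ℝ (E3 →L[ℝ] ℝ)) (hφ.continuous_fderiv one_ne_zero)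
    locallyIntegrable_newtonKernel 0
  have hK : ∀ x, newtonKernel (-x) = -newtonKernel x := fun x => by simp [newtonKernel]
  simpa [hK, ConvolutionExistsAt] using h.neg

lemma integral_Ioi_fderiv_ray {φ : E3 → ℝ} (hφ : ContDiff ℝ 1 φ) (hc : HasCompactSupport φ)
    {e : E3} (he : ‖e‖ = 1) :
    ∫ r in Set.Ioi (0 : ℝ), fderiv ℝ φ (r • e) e = -φ 0 := by
  have hd : ∀ r : ℝ, HasDerivAt (fun r : ℝ => φ (r • e)) (fderiv ℝ φ (r • e) e) r := fun r => by
    have h1 : HasDerivAt (fun r : ℝ => r • e) e r := by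
      simpa using (hasDerivAt_id r).smul_const e
    exact ((hφ.differentiable one_ne_zero) _).hasFDerivAt.comp_hasDerivAt r h1
  have hcs : HasCompactSupport (fun r : ℝ => φ (r • e)) := by
    obtain ⟨ρ, hρ⟩ := hc.isCompact.isBounded.exists_norm_le
    refine HasCompactSupport.intro (isCompact_Icc (a := -ρ) (b := ρ)) fun r hr => ?_
    by_contra h
    apply hr
    have := hρ _ (subset_tsupport _ h)
    rw [norm_smul, he, mul_one, Real.norm_eq_abs] at this
    exact abs_le.1 this
  have h := hcs.integral_Ioi_deriv_eq (by fun_prop) 0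
  simpa [fun r => (hd r).deriv] using h

/-- The Newtonian potential is the fundamental solution of `-Δ`, in weak form. -/
theorem integral_fderiv_newtonKernel {φ : E3 → ℝ} (hφ : ContDiff ℝ 1 φ)
    (hc : HasCompactSupport φ) : ∫ x, fderiv ℝ φ x (newtonKernel x) = φ 0 := by
  have hpi := Real.pi_pos
  set F : E3 → ℝ := fun x => fderiv ℝ φ x (newtonKernel x) with hF
  -- Polar coordinates: the radial weight `r ^ 2` cancels the size of the kernel, so along each ray
  -- only the radial derivative of `φ` remains, and it integrates to `-φ 0`.
  set G : Metric.sphere (0 : E3) 1 × Set.Ioi (0 : ℝ) → ℝ := fun p => F (p.2.1 • p.1.1) with hG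
  have hmp := (volume : Measure E3).measurePreserving_homeomorphUnitSphereProd
  have hemb := (homeomorphUnitSphereProd E3).measurableEmbedding
  have hGF : ∀ x : ({0}ᶜ : Set E3), G (homeomorphUnitSphereProd E3 x) = F x := fun x => by
    have hx : ‖(x : E3)‖ ≠ 0 := norm_ne_zero_iff.2 x.2
    simp [hG, smul_smul, hx]
  have hint : Integrable G ((volume : Measure E3).toSphere.prod (.volumeIoiPow 2)) := by
    have h := hmp.integrable_comp_emb (g := G) hemb
    simp only [finrank_euclideanSpace, Fintype.card_fin, Nat.add_one_sub_one] at h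
    rw [← h]
    have := (integrable_fderiv_newtonKernel hφ hc)
    rw [← restrict_compl_singleton (μ := volume) (0 : E3), ← IntegrableOn,
      integrableOn_iff_comap_subtypeVal (by measurability)] at this
    exact this.congr (.of_forall fun x => (hGF x).symm)
  have hinner : ∀ e : Metric.sphere (0 : E3) 1,
      ∫ r, G (e, r) ∂(Measure.volumeIoiPow 2) = (4 * Real.pi)⁻¹ * φ 0 := fun e => by
    have he : ‖(e : E3)‖ = 1 := by simp
    simp only [Measure.volumeIoiPow, ENNReal.ofReal]
    rw [integral_withDensity_eq_integral_smul
        ((measurable_subtype_coe.pow_const _).real_toNNReal),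
      integral_subtype_comap measurableSet_Ioi
        fun a => Real.toNNReal (a ^ 2) • F (a • (e : E3)),
      setIntegral_congr_fun (g := fun a => (-(4 * Real.pi)⁻¹) * fderiv ℝ φ (a • (e : E3)) e)
        measurableSet_Ioi fun x hx => ?_]
    · rw [integral_const_mul, integral_Ioi_fderiv_ray hφ hc he]
      ring
    · have hx0 : 0 < x := hx
      simp only [hF, newtonKernel, norm_smul, he, NNReal.smul_def,
        Real.coe_toNNReal _ (pow_nonneg hx0.le _), map_smul, smul_eq_mul,
        Real.norm_of_nonneg hx0.le]
      field_simp
  calc ∫ x, F x = ∫ x : ({0}ᶜ : Set E3), F x ∂((volume : Measure E3).comap (↑)) := by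
        rw [integral_subtype_comap (measurableSet_singleton _).compl, restrict_compl_singleton]
    _ = ∫ p, G p ∂((volume : Measure E3).toSphere.prod (.volumeIoiPow 2)) := by
        have h := hmp.integral_comp hemb G
        simp only [finrank_euclideanSpace, Fintype.card_fin, Nat.add_one_sub_one] at h
        rw [← h]
        exact integral_congr_ae (.of_forall fun x => (hGF x).symm)
    -- Every ray contributes the same amount, so only the area of the unit sphere enters: three
    -- times the volume of the unit ball, that is `4π`.
    _ = (volume : Measure E3).toSphere.real Set.univ * ((4 * Real.pi)⁻¹ * φ 0) := by
        rw [integral_prod _ hint]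
        simp [hinner]
    _ = φ 0 := by
        rw [Measure.toSphere_real_apply_univ, measureReal_def, EuclideanSpace.volume_ball_fin_three]
        simp only [finrank_euclideanSpace, Fintype.card_fin]
        rw [ENNReal.toReal_mul, ENNReal.toReal_pow, ENNReal.toReal_ofReal (by positivity),
          ENNReal.toReal_ofReal (by positivity)]
        field_simp
        norm_num

/-! ### Decay of Newtonian fields of compactly supported densities -/

/-- The pointwise decay rate `(1 + ‖y‖)⁻²` of the Newtonian kernel. -/
noncomputable def decayWeight (y : E3) : ℝ := ((1 + ‖y‖) ^ 2)⁻¹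

lemma decayWeight_pos (y : E3) : 0 < decayWeight y := by
  unfold decayWeight; positivity

lemma continuous_decayWeight : Continuous decayWeight :=
  Continuous.inv₀ (by fun_prop) fun y => by positivity

lemma memLp_decayWeight {p : ℝ≥0∞} (hp : 3 / 2 < p) : MemLp decayWeight p := by
  have hm := continuous_decayWeight.aestronglyMeasurable (μ := (volume : Measure E3))
  rcases eq_or_ne p ⊤ with rfl | hpt
  · refine memLp_top_of_bound hm 1 (.of_forall fun y => ?_)
    rw [Real.norm_of_nonneg (decayWeight_pos y).le]
    exact inv_le_one_of_one_le₀ (one_le_pow₀ (by simp))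
  have hr : 3 / 2 < p.toReal := by
    have := (ENNReal.toReal_lt_toReal (by finiteness) hpt).2 hp
    simpa using this
  rw [← integrable_norm_rpow_iff hm (pos_of_gt hp).ne' hpt]
  refine (integrable_one_add_norm (E := E3) (μ := volume) (r := 2 * p.toReal)
    (by simp; linarith)).congr (.of_forall fun y => ?_)
  have h1 : 0 < 1 + ‖y‖ := by positivity
  simp only [Real.norm_of_nonneg (decayWeight_pos y).le]
  rw [decayWeight, Real.inv_rpow (by positivity), ← Real.rpow_natCast, ← Real.rpow_mul h1.le,
    ← Real.rpow_neg h1.le]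
  norm_num

/-- For `y` near the ball the local integrability of the kernel gives a uniform bound; for `y` far
away the kernel on the ball is comparable to `‖y‖⁻²`. -/
lemma exists_eLpNorm_newtonKernel_sub_le {p : ℝ≥0∞} (hp : p < 3 / 2) {ρ : ℝ} (hρ : 0 < ρ) :
    ∃ C : ℝ≥0, ∀ y : E3, eLpNorm (fun z => newtonKernel (y - z)) p
      (volume.restrict (Metric.ball 0 ρ)) ≤ C * ENNReal.ofReal (decayWeight y) := by
  have hpi := Real.pi_pos
  obtain ⟨A, hA⟩ : ∃ A : ℝ≥0, eLpNorm newtonKernel p (volume.restrict (Metric.ball 0 (3 * ρ))) = A :=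
    ⟨_, (ENNReal.coe_toNNReal (memLp_newtonKernel hp _).2.ne).symm⟩
  obtain ⟨V, hV⟩ : ∃ V : ℝ≥0, volume (Metric.ball (0 : E3) ρ) ^ p.toReal⁻¹ = V :=
    ⟨_, (ENNReal.coe_toNNReal
      (ENNReal.rpow_ne_top_of_nonneg (by positivity) measure_ball_lt_top.ne)).symm⟩
  -- The first summand serves `‖y‖ ≤ 2ρ`, where `decayWeight y` is at least `(1 + 2ρ)⁻²`; the second
  -- serves `‖y‖ > 2ρ`, where `‖y - z‖ ≥ ‖y‖ / 2`.
  refine ⟨A * ((1 + 2 * ρ) ^ 2).toNNReal + V * (Real.pi⁻¹ * (1 + 1 / (2 * ρ)) ^ 2).toNNReal,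
    fun y => ?_⟩
  have hd := decayWeight_pos y
  push_cast
  rw [add_mul]
  rcases le_or_gt ‖y‖ (2 * ρ) with hy | hy
  · refine le_trans ?_ le_self_add
    have hmp : MeasurePreserving (fun z : E3 => y - z) := Measure.measurePreserving_sub_left volume y
    have hsub : Metric.ball (0 : E3) ρ ⊆ (fun z : E3 => y - z) ⁻¹' Metric.ball 0 (3 * ρ) := by
      intro z hz
      simp only [Metric.mem_ball, dist_zero_right, Set.mem_preimage] at hz ⊢
      linarith [norm_sub_le y z]
    calc _ ≤ eLpNorm (fun z => newtonKernel (y - z)) p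
          (volume.restrict ((fun z : E3 => y - z) ⁻¹' Metric.ball 0 (3 * ρ))) :=
          eLpNorm_mono_measure _ (Measure.restrict_mono hsub le_rfl)
      _ = A := by
          rw [← hA]
          exact eLpNorm_comp_measurePreserving measurable_newtonKernel.aestronglyMeasurable
            (hmp.restrict_preimage Metric.isOpen_ball.measurableSet)
      _ ≤ _ := by
          rw [mul_assoc]
          refine le_mul_of_one_le_right (by positivity) ?_
          rw [← ENNReal.ofReal.eq_1, ← ENNReal.ofReal_mul (by positivity), ← ENNReal.ofReal_one]
          refine ENNReal.ofReal_le_ofReal ?_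
          rw [decayWeight, ← div_eq_mul_inv, one_le_div (by positivity)]
          gcongr
  · refine le_trans ?_ le_add_self
    have hy0 : 0 < ‖y‖ := by linarith
    calc _ ≤ volume.restrict (Metric.ball (0 : E3) ρ) Set.univ ^ p.toReal⁻¹ *
          ENNReal.ofReal (Real.pi⁻¹ * (1 + 1 / (2 * ρ)) ^ 2 * decayWeight y) := by
          refine eLpNorm_le_of_ae_bound ?_
          filter_upwards [ae_restrict_mem Metric.isOpen_ball.measurableSet] with z hz
          simp only [Metric.mem_ball, dist_zero_right] at hz
          have h1 : ‖y‖ / 2 ≤ ‖y - z‖ := by linarith [norm_sub_norm_le y z]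
          rw [norm_newtonKernel, decayWeight]
          have h2 : 1 + ‖y‖ ≤ ‖y‖ * (1 + 1 / (2 * ρ)) := by
            have : 1 ≤ ‖y‖ / (2 * ρ) := by rw [one_le_div (by positivity)]; exact hy.le
            rw [mul_add, mul_one, mul_one_div]; linarith
          calc (4 * Real.pi)⁻¹ * (‖y - z‖ ^ 2)⁻¹ ≤ (4 * Real.pi)⁻¹ * ((‖y‖ / 2) ^ 2)⁻¹ := by gcongr
            _ = Real.pi⁻¹ * (1 + 1 / (2 * ρ)) ^ 2 * ((‖y‖ * (1 + 1 / (2 * ρ))) ^ 2)⁻¹ := by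
                field_simp; ring
            _ ≤ _ := by gcongr
      _ = _ := by
          rw [Measure.restrict_apply_univ, hV, ENNReal.ofReal_mul (by positivity),
            ENNReal.ofReal.eq_1 (Real.pi⁻¹ * _), mul_assoc]

/-- Hölder's inequality for the convolution of the Newtonian kernel with a compactly supported
density: it decays like `(1 + ‖y‖)⁻²`. -/
theorem exists_enorm_integral_newtonKernel_le {p q : ℝ≥0∞} [p.HolderConjugate q] (hp : p < 3 / 2)
    {ρ : ℝ} (hρ : 0 < ρ) :
    ∃ C : ℝ≥0, ∀ g : E3 → ℝ, AEStronglyMeasurable g → (∀ z ∉ Metric.ball 0 ρ, g z = 0) →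
      ∀ y : E3, ‖∫ z, g z • newtonKernel (y - z)‖ₑ ≤
        C * ENNReal.ofReal (decayWeight y) * eLpNorm g q volume := by
  obtain ⟨C, hC⟩ := exists_eLpNorm_newtonKernel_sub_le hp hρ
  refine ⟨C, fun g hg hs y => ?_⟩
  have hKm : Measurable fun z => newtonKernel (y - z) :=
    measurable_newtonKernel.comp (measurable_const.sub measurable_id)
  rw [← setIntegral_eq_integral_of_forall_compl_eq_zero (s := Metric.ball 0 ρ)
    fun z hz => by simp [hs z hz]]
  calc _ ≤ ∫⁻ z in Metric.ball 0 ρ, ‖g z • newtonKernel (y - z)‖ₑ :=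
        enorm_integral_le_lintegral_enorm _
    _ = eLpNorm (g • fun z => newtonKernel (y - z)) 1 (volume.restrict (Metric.ball 0 ρ)) := by
        rw [eLpNorm_one_eq_lintegral_enorm]; rfl
    _ ≤ eLpNorm g q (volume.restrict (Metric.ball 0 ρ)) *
          eLpNorm (fun z => newtonKernel (y - z)) p (volume.restrict (Metric.ball 0 ρ)) :=
        eLpNorm_smul_le_mul_eLpNorm hKm.aestronglyMeasurable hg.restrict
    _ ≤ eLpNorm g q volume * (C * ENNReal.ofReal (decayWeight y)) :=
        mul_le_mul' (eLpNorm_mono_measure _ Measure.restrict_le_self) (hC y)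
    _ = _ := mul_comm _ _

/-- The case `p = 1`, `q = ∞` of the Hölder bound. Being linear in the supremum of the density, it
can be applied to increments of densities and so bounds derivatives of the field. -/
lemma exists_norm_integral_newtonKernel_le {ρ : ℝ} (hρ : 0 < ρ) :
    ∃ C : ℝ, 0 ≤ C ∧ ∀ (g : E3 → ℝ) (M : ℝ), AEStronglyMeasurable g → 0 ≤ M → (∀ z, ‖g z‖ ≤ M) →
      (∀ z ∉ Metric.ball 0 ρ, g z = 0) →
      ∀ y : E3, ‖∫ z, g z • newtonKernel (y - z)‖ ≤ C * M * decayWeight y := by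
  obtain ⟨C, hC⟩ := exists_enorm_integral_newtonKernel_le (p := 1) (q := ⊤)
    (by rw [ENNReal.lt_div_iff_mul_lt (by simp) (by simp)]; norm_num) hρ
  refine ⟨C, C.2, fun g M hg hM hgM hs y => ?_⟩
  have hd := decayWeight_pos y
  have h : eLpNorm g ⊤ volume ≤ ENNReal.ofReal M := by
    rw [eLpNorm_exponent_top]
    exact eLpNormEssSup_le_of_ae_bound (.of_forall hgM)
  have h2 := (hC g hg hs y).trans (mul_le_mul_right h _)
  rw [← ENNReal.ofReal_coe_nnreal, ← ENNReal.ofReal_mul C.coe_nonneg,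
    ← ENNReal.ofReal_mul (by positivity),
    ← ofReal_norm, ENNReal.ofReal_le_ofReal_iff (by positivity)] at h2
  linarith

lemma integrable_smul_newtonKernel {h : E3 → ℝ} (hh : Continuous h) (hc : HasCompactSupport h)
    (y : E3) : Integrable fun z => h z • newtonKernel (y - z) := by
  have := hc.convolutionExists_right (μ := volume) (ContinuousLinearMap.lsmul ℝ ℝ).flip
    locallyIntegrable_newtonKernel hh y
  have := this.comp_sub_left y
  simpa using this

/-! ### Regularity, divergence and derivative decay of the field of a time-dependent density -/

/-- The gradient of the Newtonian potential of the density `g`. -/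
noncomputable def newtonField (g : E3 → ℝ → ℝ) (y : E3) (s : ℝ) : E3 :=
  ∫ z, g z s • newtonKernel (y - z)

lemma newtonField_eq_convolution (g : E3 → ℝ → ℝ) (y : E3) (s : ℝ) :
    newtonField g y s = convolution newtonKernel (fun z => g z s)
      (ContinuousLinearMap.lsmul ℝ ℝ).flip volume y := by
  rw [convolution_eq_swap]
  simp [newtonField]

section

variable {g : E3 → ℝ → ℝ} {ρ : ℝ}

lemma hasCompactSupport_slice (hs : ∀ z s, z ∉ Metric.ball (0 : E3) ρ → g z s = 0) (s : ℝ) :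
    HasCompactSupport fun z => g z s :=
  HasCompactSupport.intro (isCompact_closedBall (0 : E3) ρ)
    fun z hz => hs z s fun h => hz (Metric.ball_subset_closedBall h)

lemma contDiff_slice {E F G : Type*} [NormedAddCommGroup E] [NormedSpace ℝ E]
    [NormedAddCommGroup F] [NormedSpace ℝ F] [NormedAddCommGroup G] [NormedSpace ℝ G]
    {f : E → F → G} {n : WithTop ℕ∞} (hf : ContDiff ℝ n (Function.uncurry f)) (s : F) :
    ContDiff ℝ n fun z => f z s :=
  hf.comp (contDiff_id.prodMk contDiff_const)

lemma contDiff_newtonField (hg : ContDiff ℝ 1 (Function.uncurry g))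
    (hs : ∀ z s, z ∉ Metric.ball (0 : E3) ρ → g z s = 0) :
    ContDiff ℝ 1 (Function.uncurry (newtonField g)) := by
  have h := contDiffOn_convolution_right_with_param (𝕜 := ℝ) (n := 1) (μ := (volume : Measure E3))
    (f := newtonKernel) (g := fun s z => g z s) (s := Set.univ) (k := Metric.closedBall 0 ρ)
    (ContinuousLinearMap.lsmul ℝ ℝ).flip isOpen_univ (isCompact_closedBall _ _)
    (fun s z _ hz => hs z s fun h => hz (Metric.ball_subset_closedBall h))
    locallyIntegrable_newtonKernel
    (ContDiff.contDiffOn (hg.comp (contDiff_snd.prodMk contDiff_fst)))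
  rw [Set.univ_prod_univ, contDiffOn_univ] at h
  have h2 := h.comp (contDiff_snd.prodMk contDiff_fst : ContDiff ℝ 1 fun p : E3 × ℝ => (p.2, p.1))
  rwa [show Function.uncurry (newtonField g) = _ from
    funext fun p => newtonField_eq_convolution g p.1 p.2]

lemma sum_basisVec (x : E3) : ∑ i, x i • basisVec i = x := by
  simpa [basisVec] using (EuclideanSpace.basisFun (Fin 3) ℝ).sum_repr x

/-- The trace of a linear map, in the standard basis. -/
noncomputable def traceCLM : (E3 →L[ℝ] E3) →L[ℝ] ℝ :=
  ∑ i, (EuclideanSpace.proj i : E3 →L[ℝ] ℝ) ∘L ContinuousLinearMap.apply ℝ E3 (basisVec i)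

lemma traceCLM_apply (A : E3 →L[ℝ] E3) : traceCLM A = ∑ i, A (basisVec i) i := by
  simp [traceCLM]

/-- The derivative of the convolution falls on the density, and its trace is `-∇φ · K` with `φ x = g
(y - x) s`; the fundamental-solution identity then yields `φ 0 = g y s`. -/
lemma divergence_newtonField (hg : ContDiff ℝ 1 (Function.uncurry g))
    (hs : ∀ z s, z ∉ Metric.ball (0 : E3) ρ → g z s = 0) (y : E3) (s : ℝ) :
    divergence (fun x => newtonField g x s) y = -g y s := by
  have hgs := contDiff_slice hg s
  have hcs := hasCompactSupport_slice hs s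
  have hd := hcs.hasFDerivAt_convolution_right (μ := volume)
    (ContinuousLinearMap.lsmul ℝ ℝ).flip locallyIntegrable_newtonKernel hgs y
  have hex := (hcs.fderiv ℝ).convolutionExists_right (μ := volume)
    ((ContinuousLinearMap.lsmul ℝ ℝ).flip.precompR E3)
    locallyIntegrable_newtonKernel (hgs.continuous_fderiv one_ne_zero) y
  have hφ : ContDiff ℝ 1 fun x => g (y - x) s := hgs.comp (contDiff_const.sub contDiff_id)
  have hcφ : HasCompactSupport fun x => g (y - x) s :=
    hcs.comp_homeomorph (Homeomorph.subLeft y)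
  have h0 := integral_fderiv_newtonKernel hφ hcφ
  rw [← funext fun y => newtonField_eq_convolution g y s] at hd
  unfold divergence partialDeriv
  rw [hd.fderiv, ← traceCLM_apply, convolution, ← traceCLM.integral_comp_comm hex]
  rw [sub_zero] at h0
  rw [← h0, ← integral_neg]
  congr 1 with x
  have h1 : HasFDerivAt (fun x => g (y - x) s)
      ((fderiv ℝ (fun z => g z s) (y - x)) ∘L (-ContinuousLinearMap.id ℝ E3)) x :=
    ((hgs.differentiable one_ne_zero) (y - x)).hasFDerivAt.comp x ((hasFDerivAt_id x).const_sub y)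
  rw [h1.fderiv, traceCLM_apply]
  conv_rhs => rw [← sum_basisVec (newtonKernel x)]
  simp [ContinuousLinearMap.precompR_apply, mul_comm]

/-- A `C¹` density with compact support is bounded and Lipschitz, locally uniformly in time. -/
lemma exists_bound_lipschitz (hg : ContDiff ℝ 1 (Function.uncurry g))
    (hs : ∀ z s, z ∉ Metric.ball (0 : E3) ρ → g z s = 0) (a b : ℝ) :
    ∃ M : ℝ, 0 ≤ M ∧ (∀ z, ∀ s ∈ Set.Icc a b, ‖g z s‖ ≤ M) ∧
      ∀ z z', ∀ s ∈ Set.Icc a b, ∀ s' ∈ Set.Icc a b,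
        ‖g z s - g z' s'‖ ≤ M * ‖(z, s) - (z', s')‖ := by
  have hK : IsCompact (Metric.closedBall (0 : E3) ρ ×ˢ Set.Icc a b) :=
    (isCompact_closedBall _ _).prod isCompact_Icc
  obtain ⟨M₁, hM₁⟩ := hK.exists_bound_of_continuousOn hg.continuous.continuousOn
  obtain ⟨M₂, hM₂⟩ := hK.exists_bound_of_continuousOn
    (hg.continuous_fderiv one_ne_zero).continuousOn
  refine ⟨max 0 (max M₁ M₂), le_max_left _ _, fun z s hsI => ?_, fun z z' s hsI s' hsI' => ?_⟩
  · by_cases hz : z ∈ Metric.closedBall (0 : E3) ρ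
    · exact (hM₁ (z, s) ⟨hz, hsI⟩).trans (le_max_of_le_right (le_max_left _ _))
    · rw [hs z s fun h => hz (Metric.ball_subset_closedBall h)]
      simp
  · have hconv : Convex ℝ ((Set.univ : Set E3) ×ˢ Set.Icc a b) := convex_univ.prod (convex_Icc a b)
    refine hconv.norm_image_sub_le_of_norm_fderiv_le (𝕜 := ℝ) (f := Function.uncurry g)
      (fun x _ => (hg.differentiable one_ne_zero) x) (fun x hx => ?_) (x := (z', s')) (y := (z, s))
      ⟨trivial, hsI'⟩ ⟨trivial, hsI⟩
    by_cases hz : x.1 ∈ Metric.closedBall (0 : E3) ρ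
    · exact (hM₂ x ⟨hz, hx.2⟩).trans (le_max_of_le_right (le_max_right _ _))
    · have : Function.uncurry g =ᶠ[𝓝 x] fun _ => (0 : ℝ) := by
        have hopen : IsOpen {p : E3 × ℝ | p.1 ∉ Metric.closedBall (0 : E3) ρ} :=
          Metric.isClosed_closedBall.isOpen_compl.preimage continuous_fst
        filter_upwards [hopen.mem_nhds hz] with p hp
        exact hs p.1 p.2 fun h => hp (Metric.ball_subset_closedBall h)
      rw [this.fderiv_eq]
      simp

lemma newtonField_add_smul (y v : E3) (t s : ℝ) :
    newtonField g (y + t • v) s = ∫ z, g (z + t • v) s • newtonKernel (y - z) := by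
  rw [newtonField, ← integral_add_right_eq_self _ (t • v)]
  simp

/-- Change of variables contributes `c ^ 3` and homogeneity of the kernel `c ^ (-2)`, leaving one
factor `c`. -/
lemma newtonField_smul {c : ℝ} (hc : 0 < c) (y : E3) (s : ℝ) :
    newtonField g (c • y) s = ∫ z, (c * g (c • z) s) • newtonKernel (y - z) := by
  have h := Measure.integral_comp_smul (volume : Measure E3)
    (fun z => g z s • newtonKernel (c • y - z)) c
  rw [finrank_euclideanSpace, Fintype.card_fin, abs_of_pos (by positivity)] at h
  rw [newtonField, ← one_smul ℝ (∫ z, _), ← mul_inv_cancel₀ (pow_pos hc 3).ne', mul_smul, ← h,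
    ← integral_smul]
  refine congrArg _ (funext fun z => ?_)
  rw [← smul_sub, newtonKernel_smul hc, smul_smul, smul_smul]
  congr 1
  field_simp

/-- Decay of the field of a `C¹` compactly supported density, and of its derivatives. -/
theorem exists_newtonField_bounds (hρ : 0 < ρ) (hg : ContDiff ℝ 1 (Function.uncurry g))
    (hs : ∀ z s, z ∉ Metric.ball (0 : E3) ρ → g z s = 0) (T : ℝ) :
    ∃ C : ℝ, 0 ≤ C ∧ ∀ s ∈ Set.Icc 0 T, ∀ y,
      ‖newtonField g y s‖ ≤ C * decayWeight y ∧
      ‖timeDeriv (newtonField g) y s‖ ≤ C * decayWeight y ∧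
      (∀ i, ‖partialDeriv i (fun x => newtonField g x s) y‖ ≤ C * decayWeight y) ∧
      ‖fderiv ℝ (fun x => newtonField g x s) y y‖ ≤ C * decayWeight y := by
  -- The time interval is enlarged so that every `s` in `[0, T]` is interior, as the two-sided time
  -- derivative requires.
  obtain ⟨M, hM, hgM, hgL⟩ := exists_bound_lipschitz hg hs (-1) (T + 1)
  -- The radius `2ρ + 1` contains the supports of all perturbed densities used below: translates by
  -- less than `1`, and dilates `g (t • z)` with `t > 1/2`.
  obtain ⟨C, hC, hCK⟩ := exists_norm_integral_newtonKernel_le (ρ := 2 * ρ + 1) (by linarith)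
  have hw := contDiff_newtonField hg hs
  have hcont : ∀ s, Continuous fun z => g z s := fun s => (contDiff_slice hg s).continuous
  have hsub : ∀ z : E3, z ∉ Metric.ball (0 : E3) (2 * ρ + 1) → 2 * ρ + 1 ≤ ‖z‖ := fun z hz => by
    simpa using hz
  have hzero : ∀ (z : E3) s, ρ ≤ ‖z‖ → g z s = 0 := fun z s hz => hs z s (by simpa using hz)
  -- a Lipschitz estimate for the density along a curve gives a bound for the derivative
  have key : ∀ (t₀ : ℝ) (y : E3) (f : ℝ → E3) (f' : E3) (h : ℝ → E3 → ℝ), HasDerivAt f f' t₀ →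
      (∀ᶠ t in 𝓝 t₀, f t = ∫ z, h t z • newtonKernel (y - z)) →
      f t₀ = (∫ z, h t₀ z • newtonKernel (y - z)) →
      (∀ᶠ t in 𝓝 t₀, Continuous (h t) ∧ ∀ z, z ∉ Metric.ball (0 : E3) (2 * ρ + 1) → h t z = 0) →
      (∀ᶠ t in 𝓝 t₀, ∀ z, ‖h t z - h t₀ z‖ ≤ (1 + 2 * ρ) * M * |t - t₀|) →
      ‖f'‖ ≤ C * ((1 + 2 * ρ) * M) * decayWeight y := by
    intro t₀ y f f' h hf hfh hfh₀ hh hL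
    have hd := decayWeight_pos y
    refine hf.le_of_lip' (by positivity) ?_
    have hh₀ := hh.self_of_nhds
    have hcs : ∀ k : E3 → ℝ, (∀ z, z ∉ Metric.ball (0 : E3) (2 * ρ + 1) → k z = 0) →
        HasCompactSupport k := fun k hk =>
      HasCompactSupport.intro (isCompact_closedBall (0 : E3) (2 * ρ + 1))
        fun z hz => hk z fun h => hz (Metric.ball_subset_closedBall h)
    filter_upwards [hfh, hh, hL] with t ht hht hLt
    rw [ht, hfh₀, ← integral_sub (integrable_smul_newtonKernel hht.1 (hcs _ hht.2) y)
      (integrable_smul_newtonKernel hh₀.1 (hcs _ hh₀.2) y)]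
    simp only [← sub_smul]
    refine (hCK (fun z => h t z - h t₀ z) ((1 + 2 * ρ) * M * |t - t₀|)
      (hht.1.sub hh₀.1).aestronglyMeasurable (by positivity) hLt
      (fun z hz => by rw [hht.2 z hz, hh₀.2 z hz, sub_zero]) y).trans_eq ?_
    rw [Real.norm_eq_abs]
    ring
  -- `(1 + 2ρ) M` is the Lipschitz constant of `t * g (t • z)` at `t = 1`: `M` from the prefactor,
  -- and `2ρ M` from moving points of norm below `2ρ`. It also dominates the constant `M` of the
  -- other cases.
  refine ⟨C * ((1 + 2 * ρ) * M), by positivity, fun s hsT y => ⟨?_, ?_, fun i => ?_, ?_⟩⟩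
  · have hsI : s ∈ Set.Icc (-1) (T + 1) := ⟨by linarith [hsT.1], by linarith [hsT.2]⟩
    have hd := decayWeight_pos y
    refine (hCK (fun z => g z s) M (hcont s).aestronglyMeasurable hM (fun z => hgM z s hsI)
      (fun z hz => hzero z s (by linarith [hsub z hz])) y).trans ?_
    gcongr
    nlinarith
  · refine key s y (fun t => newtonField g y t) _ (fun t z => g z t) ?_ (.of_forall fun t => rfl)
      rfl (.of_forall fun t => ⟨hcont t, fun z hz => hzero z t (by linarith [hsub z hz])⟩) ?_
    · have h1 : ContDiff ℝ 1 fun t => newtonField g y t :=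
        hw.comp (contDiff_const.prodMk contDiff_id)
      exact ((h1.differentiable one_ne_zero) s).hasDerivAt
    · have hsI : s ∈ Set.Ioo (-1) (T + 1) := ⟨by linarith [hsT.1], by linarith [hsT.2]⟩
      filter_upwards [isOpen_Ioo.mem_nhds hsI] with t ht z
      refine (hgL z z t (Set.Ioo_subset_Icc_self ht) s (Set.Ioo_subset_Icc_self hsI)).trans ?_
      simp only [Prod.mk_sub_mk, sub_self, Prod.norm_mk, norm_zero, Real.norm_eq_abs,
        sup_of_le_right (abs_nonneg _)]
      gcongr
      nlinarith
  · have hsI : s ∈ Set.Icc (-1) (T + 1) := ⟨by linarith [hsT.1], by linarith [hsT.2]⟩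
    have hv : ‖basisVec i‖ = 1 := by simp [basisVec]
    refine key 0 y (fun t => newtonField g (y + t • basisVec i) s) _
      (fun t z => g (z + t • basisVec i) s) ?_
      (.of_forall fun t => newtonField_add_smul _ _ _ _) (newtonField_add_smul _ _ _ _) ?_ ?_
    · have h1 : HasDerivAt (fun t : ℝ => y + t • basisVec i) (basisVec i) 0 := by
        simpa using ((hasDerivAt_id (0 : ℝ)).smul_const (basisVec i)).const_add y
      have h2 := ((contDiff_slice hw s).differentiable one_ne_zero (y + (0 : ℝ) • basisVec i)).hasFDerivAt
      have h3 := h2.comp_hasDerivAt 0 h1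
      simp only [zero_smul, add_zero] at h3
      exact h3
    · filter_upwards [Metric.ball_mem_nhds (0 : ℝ) one_pos] with t ht
      refine ⟨(hcont s).comp (by fun_prop), fun z hz => hzero _ s ?_⟩
      have h1 := hsub z hz
      have h2 : ‖t • basisVec i‖ < 1 := by rw [norm_smul, hv]; simpa using ht
      linarith [norm_sub_le (z + t • basisVec i) (t • basisVec i),
        (by simp : ‖z + t • basisVec i - t • basisVec i‖ = ‖z‖)]
    · refine .of_forall fun t z => (hgL _ _ s hsI s hsI).trans ?_
      simp only [zero_smul, add_zero, Prod.mk_sub_mk, sub_self, Prod.norm_mk, norm_zero,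
        add_sub_cancel_left, norm_smul, hv, mul_one, sub_zero, Real.norm_eq_abs,
        sup_of_le_left (abs_nonneg _)]
      gcongr
      nlinarith
  · have hsI : s ∈ Set.Icc (-1) (T + 1) := ⟨by linarith [hsT.1], by linarith [hsT.2]⟩
    have hev : ∀ᶠ t : ℝ in 𝓝 1, 1 / 2 < t := lt_mem_nhds (by norm_num)
    -- The radial derivative is the derivative of `t ↦ newtonField g (t • y) s` at `t = 1`. The
    -- dilation identity transfers it to the density, whose support is bounded, so the unbounded
    -- factor `y` disappears.
    refine key 1 y (fun t => newtonField g (t • y) s) _ (fun t z => t * g (t • z) s) ?_ ?_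
      (newtonField_smul one_pos _ _) ?_ ?_
    · have h1 : HasDerivAt (fun t : ℝ => t • y) y 1 := by
        simpa using (hasDerivAt_id (1 : ℝ)).smul_const y
      have h2 := ((contDiff_slice hw s).differentiable one_ne_zero ((1 : ℝ) • y)).hasFDerivAt
      have h3 := h2.comp_hasDerivAt 1 h1
      simp only [one_smul] at h3
      exact h3
    · filter_upwards [hev] with t ht
      exact newtonField_smul (by linarith) _ _
    · filter_upwards [hev] with t ht
      refine ⟨continuous_const.mul ((hcont s).comp (by fun_prop)), fun z hz => ?_⟩
      have h1 := hsub z hz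
      rw [hzero _ s, mul_zero]
      rw [norm_smul, Real.norm_of_nonneg (by linarith)]
      nlinarith
    · filter_upwards [hev] with t ht z
      simp only [one_mul, one_smul]
      rcases le_or_gt (2 * ρ) ‖z‖ with hz | hz
      · rw [hzero z s (by linarith), hzero (t • z) s, mul_zero, sub_zero, norm_zero]
        · positivity
        · rw [norm_smul, Real.norm_of_nonneg (by linarith)]
          nlinarith
      · have h1 := hgL (t • z) z s hsI s hsI
        have h2 := hgM (t • z) s hsI
        simp only [Prod.mk_sub_mk, sub_self, Prod.norm_mk, norm_zero,
          max_eq_left (norm_nonneg _)] at h1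
        have h3 : ‖t • z - z‖ = |t - 1| * ‖z‖ := by
          rw [← Real.norm_eq_abs, ← norm_smul, sub_smul, one_smul]
        rw [h3] at h1
        calc ‖t * g (t • z) s - g z s‖ = ‖(t - 1) * g (t • z) s + (g (t • z) s - g z s)‖ := by
              congr 1; ring
          _ ≤ |t - 1| * M + M * (|t - 1| * (2 * ρ)) := by
              refine (norm_add_le _ _).trans (add_le_add ?_ (h1.trans ?_))
              · rw [norm_mul, Real.norm_eq_abs]
                gcongr
              · gcongr
          _ = _ := by ring

end

/-! ### The cutoff, dilations and the scale-invariant bound -/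

section

variable {Z : E3 → ℝ} {R : ℝ}

lemma contDiff_rescaledCutoff (hZ : IsCutoff Z) (R : ℝ) : ContDiff ℝ ∞ (rescaledCutoff Z R) :=
  hZ.smooth.comp (contDiff_const_smul _)

lemma contDiff_gradient_rescaledCutoff (hZ : IsCutoff Z) (R : ℝ) :
    ContDiff ℝ 1 (gradient (rescaledCutoff Z R)) := by
  have h := (contDiff_rescaledCutoff hZ R).fderiv_right (m := 1) (by norm_cast)
  exact (InnerProductSpace.toDual ℝ E3).symm.toContinuousLinearEquiv.contDiff.comp h

lemma gradient_eq_zero_of_eventuallyEq_const {f : E3 → ℝ} {x : E3} {c : ℝ}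
    (h : f =ᶠ[𝓝 x] fun _ => c) : gradient f x = 0 := by
  rw [gradient, h.fderiv_eq]
  simp

lemma norm_inv_smul (hR : 0 < R) (z : E3) : ‖R⁻¹ • z‖ = ‖z‖ / R := by
  rw [norm_smul, norm_inv, Real.norm_of_nonneg hR.le, inv_mul_eq_div]

lemma gradient_rescaledCutoff_of_lt (hZ : IsCutoff Z) (hR : 0 < R) {z : E3} (hz : ‖z‖ < R) :
    gradient (rescaledCutoff Z R) z = 0 := by
  refine gradient_eq_zero_of_eventuallyEq_const (c := 0) ?_
  filter_upwards [(isOpen_lt continuous_norm continuous_const).mem_nhds hz] with x hx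
  refine hZ.eq_zero _ ?_
  rw [norm_inv_smul hR, div_lt_one hR]
  exact hx

lemma gradient_rescaledCutoff_of_gt (hZ : IsCutoff Z) (hR : 0 < R) {z : E3} (hz : 2 * R < ‖z‖) :
    gradient (rescaledCutoff Z R) z = 0 := by
  refine gradient_eq_zero_of_eventuallyEq_const (c := 1) ?_
  filter_upwards [(isOpen_lt continuous_const continuous_norm).mem_nhds hz] with x hx
  refine hZ.eq_one _ ?_
  rw [norm_inv_smul hR, lt_div_iff₀ hR]
  exact hx

lemma rescaledCutoff_one : rescaledCutoff Z 1 = Z := by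
  ext; simp [rescaledCutoff]

lemma gradient_rescaledCutoff_smul (hZ : IsCutoff Z) (hR : 0 < R) (z : E3) :
    gradient (rescaledCutoff Z R) (R • z) = R⁻¹ • gradient Z z := by
  apply HasGradientAt.gradient
  rw [hasGradientAt_iff_hasFDerivAt]
  have h1 : HasFDerivAt (fun y : E3 => R⁻¹ • y) (R⁻¹ • ContinuousLinearMap.id ℝ E3) (R • z) :=
    (hasFDerivAt_id _).const_smul R⁻¹
  have h2 : HasFDerivAt Z (fderiv ℝ Z z) (R⁻¹ • R • z) := by
    rw [smul_smul, inv_mul_cancel₀ hR.ne', one_smul]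
    exact ((hZ.smooth.differentiable (by simp)) z).hasFDerivAt
  refine (h2.comp _ h1).congr_fderiv ?_
  ext v
  simp [gradient]

/-- The density `∇ξ · U₀`, with `ξ` the rescaled cutoff. -/
noncomputable def cutoffDensity (Z : E3 → ℝ) (R : ℝ) (U₀ : E3 → ℝ → E3) (z : E3) (s : ℝ) : ℝ :=
  inner ℝ (gradient (rescaledCutoff Z R) z) (U₀ z s)

variable {U₀ : E3 → ℝ → E3}

lemma contDiff_cutoffDensity (hZ : IsCutoff Z) (hU : ContDiff ℝ 1 (Function.uncurry U₀)) :
    ContDiff ℝ 1 (Function.uncurry (cutoffDensity Z R U₀)) :=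
  ((contDiff_gradient_rescaledCutoff hZ R).comp contDiff_fst).inner ℝ hU

lemma cutoffDensity_eq_zero (hZ : IsCutoff Z) (hR : 0 < R) (z : E3) (s : ℝ)
    (hz : z ∉ Metric.ball (0 : E3) (2 * R + 1)) : cutoffDensity Z R U₀ z s = 0 := by
  have hz' : 2 * R + 1 ≤ ‖z‖ := by simpa using hz
  rw [cutoffDensity, gradient_rescaledCutoff_of_gt hZ hR (by linarith), inner_zero_left]

lemma correctionIntegrand_ae_eq (Z : E3 → ℝ) (R : ℝ) (U₀ : E3 → ℝ → E3) (y : E3) (s : ℝ) :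
    correctionIntegrand Z R U₀ y s =ᵐ[volume]
      fun z => cutoffDensity Z R U₀ z s • newtonKernel (y - z) := by
  filter_upwards [(measure_eq_zero_iff_ae_notMem.1 (measure_singleton y) : ∀ᵐ z, z ∉ ({y} : Set E3))]
    with z hz
  rw [correctionIntegrand, gradient_newtonPotential (Ne.symm hz), cutoffDensity]

lemma correction_eq_newtonField (Z : E3 → ℝ) (R : ℝ) (U₀ : E3 → ℝ → E3) :
    correction Z R U₀ = newtonField (cutoffDensity Z R U₀) := by
  ext1 y
  ext1 s
  exact integral_congr_ae (correctionIntegrand_ae_eq Z R U₀ y s)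

lemma integrable_correctionIntegrand (hZ : IsCutoff Z) (hR : 0 < R)
    (hU : ContDiff ℝ 1 (Function.uncurry U₀)) (y : E3) (s : ℝ) :
    Integrable (correctionIntegrand Z R U₀ y s) :=
  (integrable_smul_newtonKernel (contDiff_slice (contDiff_cutoffDensity hZ hU) s).continuous
    (hasCompactSupport_slice (cutoffDensity_eq_zero hZ hR) s) y).congr
    (correctionIntegrand_ae_eq Z R U₀ y s).symm

/-- The factor by which the `L^q` norm on `ℝ³` changes under the dilation by `R`. -/
noncomputable def dilationFactor (R : ℝ) (q : ℝ≥0∞) : ℝ≥0∞ :=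
  ENNReal.ofReal |(R ^ 3)⁻¹| ^ (1 / q).toReal

lemma dilationFactor_ne_zero (hR : 0 < R) (q : ℝ≥0∞) : dilationFactor R q ≠ 0 := by
  have : ENNReal.ofReal |(R ^ 3)⁻¹| ≠ 0 := by
    rw [abs_of_pos (by positivity)]; simpa using by positivity
  exact (ENNReal.rpow_pos (pos_iff_ne_zero.2 this) ENNReal.ofReal_ne_top).ne'

lemma dilationFactor_ne_top (q : ℝ≥0∞) : dilationFactor R q ≠ ⊤ :=
  ENNReal.rpow_ne_top_of_nonneg ENNReal.toReal_nonneg ENNReal.ofReal_ne_top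

lemma eLpNorm_comp_smul {F : Type*} [NormedAddCommGroup F] (hR : 0 < R) (f : E3 → F) (q : ℝ≥0∞)
    (S : Set E3) :
    eLpNorm (fun y => f (R • y)) q (volume.restrict ((fun y => R • y) ⁻¹' S)) =
      dilationFactor R q * eLpNorm f q (volume.restrict S) := by
  have hemb : MeasurableEmbedding fun y : E3 => R • y :=
    (Homeomorph.smulOfNeZero R hR.ne').measurableEmbedding
  have hc : ENNReal.ofReal |(R ^ 3)⁻¹| ≠ 0 := by
    rw [abs_of_pos (by positivity)]; simpa using by positivity
  have h := hemb.eLpNorm_map_measure (g := f) (p := q)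
    (μ := volume.restrict ((fun y => R • y) ⁻¹' S))
  rw [← hemb.restrict_map, Measure.map_addHaar_smul volume hR.ne', finrank_euclideanSpace,
    Fintype.card_fin, Measure.restrict_smul, eLpNorm_smul_measure_of_ne_zero hc] at h
  exact h.symm

/-- The conjugate exponent is `1 + (q - 1)⁻¹`, so `q > 3` is exactly what the local integrability of
the kernel needs; `q = ∞` is included. -/
lemma exists_holderConjugate_lt {q : ℝ≥0∞} (hq : 3 < q) :
    ∃ p : ℝ≥0∞, p.HolderConjugate q ∧ p < 3 / 2 := by
  have h1 : 1 ≤ q := le_trans (by norm_num) hq.le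
  refine ⟨q.conjExponent, (ENNReal.HolderConjugate.conjExponent h1).symm, ?_⟩
  have h2 : (q - 1)⁻¹ < 2⁻¹ := by
    rw [ENNReal.inv_lt_inv, lt_tsub_iff_right]
    norm_num [hq]
  have h3 : (3 / 2 : ℝ≥0∞) = 1 + 2⁻¹ := by
    rw [show (3 : ℝ≥0∞) = 2 + 1 by norm_num, ENNReal.add_div, ENNReal.div_self (by simp) (by simp),
      one_div]
  rw [ENNReal.conjExponent, h3]
  exact ENNReal.add_lt_add_left (by simp) h2

/-- The scale invariant `L^q` bound for the correction, uniform in the radius. -/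
theorem exists_eLpNorm_correction_le (hZ : IsCutoff Z) {q : ℝ≥0∞} (hq : 3 < q) :
    ∃ C : ℝ≥0, ∀ R : ℝ, 0 < R → ∀ (U : E3 → ℝ → E3) (s : ℝ), Continuous (fun y => U y s) →
      eLpNorm (fun y => correction Z R U y s) q volume ≤
        C * eLpNorm (fun y => U y s) q (volume.restrict (Metric.ball (0 : E3) R)ᶜ) := by
  obtain ⟨p, hpq, hp⟩ := exists_holderConjugate_lt hq
  obtain ⟨A, hA⟩ := exists_enorm_integral_newtonKernel_le (p := p) (q := q) hp
    (by norm_num : (0 : ℝ) < 3)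
  have hgc : Continuous (gradient Z) := by
    have := (contDiff_gradient_rescaledCutoff hZ 1).continuous
    rwa [rescaledCutoff_one] at this
  have hlt : ∀ z : E3, ‖z‖ < 1 → gradient Z z = 0 := fun z hz => by
    simpa [rescaledCutoff_one] using gradient_rescaledCutoff_of_lt hZ one_pos hz
  have hgt : ∀ z : E3, 2 < ‖z‖ → gradient Z z = 0 := fun z hz => by
    simpa [rescaledCutoff_one] using gradient_rescaledCutoff_of_gt (R := 1) hZ one_pos (by simpa using hz)
  obtain ⟨M, hM⟩ : ∃ M : ℝ≥0, ∀ z, ‖gradient Z z‖ ≤ M := by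
    obtain ⟨M, hM⟩ := hgc.bounded_above_of_compact_support
      (HasCompactSupport.intro (isCompact_closedBall (0 : E3) 2)
        fun z hz => hgt z (by simpa using hz))
    exact ⟨M.toNNReal, fun z => (hM z).trans (Real.le_coe_toNNReal M)⟩
  have hdec := memLp_decayWeight (p := q) (lt_of_le_of_lt (by
    rw [ENNReal.div_le_iff (by simp) (by simp)]; norm_num) hq)
  obtain ⟨D, hD⟩ : ∃ D : ℝ≥0, eLpNorm decayWeight q volume = D :=
    ⟨_, (ENNReal.coe_toNNReal hdec.2.ne).symm⟩
  refine ⟨A * D * M, fun R hR U s hU => ?_⟩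
  -- The density at unit scale: the factor `R` from dilating the field cancels the `R⁻¹` from the
  -- gradient of the rescaled cutoff.
  set h : E3 → ℝ := fun z => inner ℝ (gradient Z z) (U (R • z) s) with hh
  have hhc : Continuous h := hgc.inner (hU.comp (continuous_const_smul R))
  have hscale : ∀ y, correction Z R U (R • y) s = ∫ z, h z • newtonKernel (y - z) := fun y => by
    rw [correction_eq_newtonField, newtonField_smul hR]
    refine integral_congr_ae (.of_forall fun z => ?_)
    beta_reduce
    rw [cutoffDensity, gradient_rescaledCutoff_smul hZ hR, inner_smul_left, ← mul_assoc]
    simp [hR.ne', hh]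
  set N := eLpNorm (fun y => U y s) q (volume.restrict (Metric.ball (0 : E3) R)ᶜ)
  have hpre : (fun y : E3 => R • y) ⁻¹' (Metric.ball (0 : E3) R)ᶜ = (Metric.ball (0 : E3) 1)ᶜ := by
    ext y
    simp [norm_smul, abs_of_pos hR, hR]
  -- `gradient Z` vanishes in the unit ball, so after undoing the dilation only the values of `U`
  -- outside `B_R` are seen.
  have hhN : eLpNorm h q volume ≤ M * (dilationFactor R q * N) := by
    have h0 : h = (Metric.ball (0 : E3) 1)ᶜ.indicator h := by
      refine (Set.indicator_eq_self.2 fun z hz => ?_).symm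
      intro hz'
      exact hz (by simp only [hh, hlt z (by simpa using hz'), inner_zero_left])
    rw [h0, eLpNorm_indicator_eq_eLpNorm_restrict Metric.isOpen_ball.measurableSet.compl,
      ← eLpNorm_comp_smul hR _ q, hpre]
    refine (eLpNorm_le_nnreal_smul_eLpNorm_of_ae_le_mul (c := M) (.of_forall fun z => ?_) q).trans_eq
      (by rw [ENNReal.smul_def, smul_eq_mul])
    rw [← NNReal.coe_le_coe]
    push_cast
    exact (norm_inner_le_norm _ _).trans (by gcongr; exact hM z)
  have hhcs : HasCompactSupport h :=
    HasCompactSupport.intro (isCompact_closedBall (0 : E3) 2) fun z hz => by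
      simp only [hh, hgt z (by simpa using hz), inner_zero_left]
  have hwN : dilationFactor R q * eLpNorm (fun y => correction Z R U y s) q volume ≤
      A * eLpNorm h q volume * D := by
    have h1 := eLpNorm_comp_smul hR (fun y => correction Z R U y s) q Set.univ
    simp only [Set.preimage_univ, Measure.restrict_univ, hscale] at h1
    rw [← h1, ← hD]
    obtain ⟨H, hH⟩ : ∃ H : ℝ≥0, eLpNorm h q volume = H :=
      ⟨_, (ENNReal.coe_toNNReal (hhc.memLp_of_hasCompactSupport hhcs).2.ne).symm⟩
    rw [hH, ← ENNReal.coe_mul, ← smul_eq_mul, ← ENNReal.smul_def]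
    refine eLpNorm_le_nnreal_smul_eLpNorm_of_ae_le_mul' (.of_forall fun y => ?_) q
    refine (hA h hhc.aestronglyMeasurable (fun z hz => ?_) y).trans_eq ?_
    · have : (3 : ℝ) ≤ ‖z‖ := by simpa using hz
      simp only [hh, hgt z (by linarith), inner_zero_left]
    · rw [hH, ← ofReal_norm, Real.norm_of_nonneg (decayWeight_pos y).le]
      push_cast
      ring
  -- Both sides carry the same dilation factor; cancelling it removes the dependence on `R`.
  rw [← ENNReal.mul_le_mul_iff_right (dilationFactor_ne_zero hR q) (dilationFactor_ne_top q)]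
  refine hwN.trans ((mul_le_mul_left (mul_le_mul_right hhN _) _).trans_eq ?_)
  push_cast
  ring

end

/-! ### The pairing and bounds in the dual of `H¹` -/

section

variable {V : E3 → ℝ → E3}

lemma hasFDerivAt_slice (hV : ContDiff ℝ 1 (Function.uncurry V)) (y : E3) (s : ℝ) :
    HasFDerivAt (fun x => V x s)
      (fderiv ℝ (Function.uncurry V) (y, s) ∘L ContinuousLinearMap.inl ℝ E3 ℝ) y :=
  HasFDerivAt.comp (g := Function.uncurry V) (f := fun x => (x, s)) y
    ((hV.differentiable one_ne_zero) (y, s)).hasFDerivAt (hasFDerivAt_prodMk_left y s)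

lemma hasDerivAt_timeDeriv (hV : ContDiff ℝ 1 (Function.uncurry V)) (y : E3) (s : ℝ) :
    HasDerivAt (fun t => V y t) (timeDeriv V y s) s := by
  have h : ContDiff ℝ 1 fun t => V y t := hV.comp (contDiff_const.prodMk contDiff_id)
  exact ((h.differentiable one_ne_zero) s).hasDerivAt

lemma timeDeriv_eq (hV : ContDiff ℝ 1 (Function.uncurry V)) (y : E3) (s : ℝ) :
    timeDeriv V y s = fderiv ℝ (Function.uncurry V) (y, s) (0, 1) := by
  have h := ((hV.differentiable one_ne_zero) (y, s)).hasFDerivAt.comp_hasDerivAt s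
    ((hasDerivAt_const s y).prodMk (hasDerivAt_id s))
  exact h.deriv

lemma continuous_timeDeriv (hV : ContDiff ℝ 1 (Function.uncurry V)) (s : ℝ) :
    Continuous fun y => timeDeriv V y s := by
  simp only [timeDeriv_eq hV]
  have := hV.continuous_fderiv one_ne_zero
  fun_prop

lemma continuous_partialDeriv {ζ : E3 → E3} (hζ : ContDiff ℝ 1 ζ) (i : Fin 3) :
    Continuous (partialDeriv i ζ) :=
  (hζ.continuous_fderiv one_ne_zero).clm_apply continuous_const

lemma hasCompactSupport_partialDeriv {ζ : E3 → E3} (hζ : HasCompactSupport ζ) (i : Fin 3) :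
    HasCompactSupport (partialDeriv i ζ) :=
  (hζ.fderiv ℝ).comp_left (g := fun A : E3 →L[ℝ] E3 => A (basisVec i)) rfl

lemma norm_basisVec (i : Fin 3) : ‖basisVec i‖ = 1 := by simp [basisVec]

lemma norm_partialDeriv_slice_le (hV : ContDiff ℝ 1 (Function.uncurry V)) (i : Fin 3) (y : E3)
    (s : ℝ) : ‖partialDeriv i (fun x => V x s) y‖ ≤ ‖fderiv ℝ (Function.uncurry V) (y, s)‖ := by
  rw [partialDeriv, (hasFDerivAt_slice hV y s).fderiv]
  refine (ContinuousLinearMap.le_opNorm _ (basisVec i, (0 : ℝ))).trans ?_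
  simp [norm_basisVec]

lemma integrable_pairing_lower (hV : ContDiff ℝ 1 (Function.uncurry V)) (s : ℝ) {ζ : E3 → E3}
    (hζ : IsTestField ζ) : Integrable fun y =>
      (inner ℝ (timeDeriv V y s - V y s - fderiv ℝ (fun x => V x s) y y) (ζ y) : ℝ) := by
  have h1 := continuous_timeDeriv hV s
  have h2 := contDiff_slice hV s
  have h3 : Continuous fun y => fderiv ℝ (fun x => V x s) y y :=
    (h2.continuous_fderiv one_ne_zero).clm_apply continuous_id
  refine (((h1.sub h2.continuous).sub h3).inner hζ.1.continuous).integrable_of_hasCompactSupport ?_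
  exact hζ.2.mono fun y hy h => hy (by simp [h])

lemma integrable_pairing_gradient (hV : ContDiff ℝ 1 (Function.uncurry V)) (s : ℝ) {ζ : E3 → E3}
    (hζ : IsTestField ζ) : Integrable fun y => ∑ i : Fin 3,
      (inner ℝ (partialDeriv i (fun x => V x s) y) (partialDeriv i ζ y) : ℝ) := by
  refine integrable_finsetSum _ fun i _ => ?_
  refine ((continuous_partialDeriv (contDiff_slice hV s) i).inner
    (continuous_partialDeriv hζ.1 i)).integrable_of_hasCompactSupport ?_
  exact (hasCompactSupport_partialDeriv hζ.2 i).mono fun y hy h => hy (by simp [h])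

/-- A pairing whose difference from a vanishing one is controlled by the decay weight is bounded
in the dual of `H¹`. -/
lemma abs_le_of_norm_le_decayWeight {C : ℝ} (hC : 0 ≤ C) {ζ : E3 → E3} (hζ : IsTestField ζ)
    (h1 : sqNormH1 ζ ≤ 1) {a b : E3 → ℝ}
    (ha : ∀ y, ‖a y‖ ≤ C * decayWeight y * ‖ζ y‖)
    (hb : ∀ y, ‖b y‖ ≤ ∑ i, C * decayWeight y * (‖partialDeriv i ζ y‖ + ‖ζ y‖)) :
    |(∫ y, a y) + ∫ y, b y| ≤ C * (7 * (∫ y, decayWeight y ^ 2) + 4) := by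
  have hd : Integrable fun y => decayWeight y ^ 2 :=
    (memLp_decayWeight (p := 2) (by
      rw [ENNReal.div_lt_iff (by simp) (by simp)]; norm_num)).integrable_sq
  have hz : Integrable fun y => ‖ζ y‖ ^ 2 :=
    (hζ.1.continuous.norm.pow 2).integrable_of_hasCompactSupport
      (hζ.2.mono fun y hy h => hy (by simp [h]))
  have hp : Integrable fun y => ∑ i : Fin 3, ‖partialDeriv i ζ y‖ ^ 2 := by
    refine integrable_finsetSum _ fun i _ => ?_
    exact ((continuous_partialDeriv hζ.1 i).norm.pow 2).integrable_of_hasCompactSupport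
      ((hasCompactSupport_partialDeriv hζ.2 i).mono fun y hy h => hy (by simp [h]))
  have amgm : ∀ x y : ℝ, x * y ≤ x ^ 2 + y ^ 2 := fun x y => by
    nlinarith [sq_nonneg (x - y), sq_nonneg x, sq_nonneg y]
  have hA : ‖∫ y, a y‖ ≤ ∫ y, C * (decayWeight y ^ 2 + ‖ζ y‖ ^ 2) := by
    refine norm_integral_le_of_norm_le ((hd.add hz).const_mul C) (.of_forall fun y => ?_)
    refine (ha y).trans ?_
    rw [mul_assoc]
    exact mul_le_mul_of_nonneg_left (amgm _ _) hC
  have h63 : Integrable fun y => 6 * decayWeight y ^ 2 + 3 * ‖ζ y‖ ^ 2 :=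
    (hd.const_mul 6).add (hz.const_mul 3)
  have hB : ‖∫ y, b y‖ ≤ ∫ y, C * (6 * decayWeight y ^ 2 + 3 * ‖ζ y‖ ^ 2 +
      ∑ i : Fin 3, ‖partialDeriv i ζ y‖ ^ 2) := by
    refine norm_integral_le_of_norm_le
      ((h63.add hp).const_mul C) (.of_forall fun y => ?_)
    refine (hb y).trans ?_
    simp only [mul_assoc]
    rw [← Finset.mul_sum]
    refine mul_le_mul_of_nonneg_left ?_ hC
    calc ∑ i, decayWeight y * (‖partialDeriv i ζ y‖ + ‖ζ y‖)
        ≤ ∑ i : Fin 3, (2 * decayWeight y ^ 2 + ‖ζ y‖ ^ 2 + ‖partialDeriv i ζ y‖ ^ 2) := by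
          refine Finset.sum_le_sum fun i _ => ?_
          linarith [amgm (decayWeight y) ‖partialDeriv i ζ y‖, amgm (decayWeight y) ‖ζ y‖]
      _ = _ := by
          rw [Finset.sum_add_distrib, Finset.sum_const]
          simp
          ring
  rw [integral_const_mul, integral_add hd hz] at hA
  rw [integral_const_mul, integral_add h63 hp,
    integral_add (hd.const_mul 6) (hz.const_mul 3), integral_const_mul, integral_const_mul] at hB
  have hp0 : 0 ≤ ∫ y, ∑ i : Fin 3, ‖partialDeriv i ζ y‖ ^ 2 :=
    integral_nonneg fun y => Finset.sum_nonneg fun i _ => by positivity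
  have hz0 : 0 ≤ ∫ y, ‖ζ y‖ ^ 2 := integral_nonneg fun y => by positivity
  -- The two bounds add up to `7 ∫ d² + 4 ∫ ‖ζ‖² + ∫ ∑ ‖∂ᵢζ‖²` with `d` the decay weight; as the
  -- squared `H¹` norm is at most `1`, the last two terms contribute at most `4`.
  rw [sqNormH1] at h1
  rw [← Real.norm_eq_abs]
  refine (norm_add_le _ _).trans ((add_le_add hA hB).trans ?_)
  rw [← mul_add]
  refine mul_le_mul_of_nonneg_left ?_ hC
  linarith

lemma exists_norm_le_decayWeight {f : E3 → ℝ → ℝ} (hf : Continuous (Function.uncurry f)) {r : ℝ}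
    (h0 : ∀ y s, r < ‖y‖ → f y s = 0) (T : ℝ) :
    ∃ C : ℝ, 0 ≤ C ∧ ∀ s ∈ Set.Icc 0 T, ∀ y, ‖f y s‖ ≤ C * decayWeight y := by
  have hK : IsCompact (Metric.closedBall (0 : E3) r ×ˢ Set.Icc 0 T) :=
    (isCompact_closedBall _ _).prod isCompact_Icc
  have hF : Continuous fun p : E3 × ℝ => f p.1 p.2 * (1 + ‖p.1‖) ^ 2 := hf.mul (by fun_prop)
  obtain ⟨C, hC⟩ := hK.exists_bound_of_continuousOn hF.continuousOn
  refine ⟨max 0 C, le_max_left _ _, fun s hs y => ?_⟩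
  have hy0 : 0 < (1 + ‖y‖) ^ 2 := by positivity
  rcases lt_or_ge r ‖y‖ with hy | hy
  · have := decayWeight_pos y
    rw [h0 y s hy, norm_zero]
    positivity
  · rw [decayWeight, ← div_eq_mul_inv, le_div_iff₀ hy0]
    have := hC (y, s) ⟨by simpa using hy, hs⟩
    rw [norm_mul, Real.norm_of_nonneg hy0.le] at this
    exact this.trans (le_max_right _ _)

lemma linftyLpNorm_le {f : E3 → ℝ → E3} {p : ℝ≥0∞} {T : ℝ} {μ : Measure E3} {C : ℝ≥0∞}
    (h : ∀ᵐ s ∂volume.restrict (Set.Ioo 0 T), eLpNorm (fun y => f y s) p μ ≤ C) :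
    linftyLpNorm f p T μ ≤ C :=
  essSup_le_of_ae_le C h

end

/-! ### The revised profile -/

section

variable {Z : E3 → ℝ} {R : ℝ} {U₀ : E3 → ℝ → E3}

lemma contDiff_correction (hZ : IsCutoff Z) (hR : 0 < R) (hU : ContDiff ℝ 1 (Function.uncurry U₀)) :
    ContDiff ℝ 1 (Function.uncurry (correction Z R U₀)) := by
  rw [correction_eq_newtonField]
  exact contDiff_newtonField (contDiff_cutoffDensity hZ hU) (cutoffDensity_eq_zero hZ hR)

lemma contDiff_revisedProfile (hZ : IsCutoff Z) (hR : 0 < R)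
    (hU : ContDiff ℝ 1 (Function.uncurry U₀)) :
    ContDiff ℝ 1 (Function.uncurry (revisedProfile Z R U₀)) :=
  ((((contDiff_rescaledCutoff hZ R).of_le (by norm_cast)).comp contDiff_fst).smul hU).add
    (contDiff_correction hZ hR hU)

lemma hasFDerivAt_rescaledCutoff (hZ : IsCutoff Z) (R : ℝ) (y : E3) :
    HasFDerivAt (rescaledCutoff Z R) (fderiv ℝ (rescaledCutoff Z R) y) y :=
  (((contDiff_rescaledCutoff hZ R).differentiable (by simp)) y).hasFDerivAt

lemma fderiv_revisedProfile (hZ : IsCutoff Z) (hR : 0 < R)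
    (hU : ContDiff ℝ 1 (Function.uncurry U₀)) (y : E3) (s : ℝ) :
    fderiv ℝ (fun x => revisedProfile Z R U₀ x s) y =
      rescaledCutoff Z R y • fderiv ℝ (fun x => U₀ x s) y +
        (fderiv ℝ (rescaledCutoff Z R) y).smulRight (U₀ y s) +
        fderiv ℝ (fun x => correction Z R U₀ x s) y := by
  have h1 := ((contDiff_slice hU s).differentiable one_ne_zero y).hasFDerivAt
  have h2 := ((contDiff_slice (contDiff_correction hZ hR hU) s).differentiable
    one_ne_zero y).hasFDerivAt
  exact (((hasFDerivAt_rescaledCutoff hZ R y).smul h1).add h2).fderiv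

lemma timeDeriv_revisedProfile (hZ : IsCutoff Z) (hR : 0 < R)
    (hU : ContDiff ℝ 1 (Function.uncurry U₀)) (y : E3) (s : ℝ) :
    timeDeriv (revisedProfile Z R U₀) y s =
      rescaledCutoff Z R y • timeDeriv U₀ y s + timeDeriv (correction Z R U₀) y s :=
  (((hasDerivAt_timeDeriv hU y s).const_smul (rescaledCutoff Z R y)).add
    (hasDerivAt_timeDeriv (contDiff_correction hZ hR hU) y s)).deriv

/-- The product rule leaves `∇ξ · U₀`, and the correction has divergence exactly `-∇ξ · U₀`. -/
lemma divergence_revisedProfile (hZ : IsCutoff Z) (hR : 0 < R)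
    (hU : ContDiff ℝ 1 (Function.uncurry U₀)) {y : E3} {s : ℝ}
    (hdiv : divergence (fun x => U₀ x s) y = 0) :
    divergence (fun x => revisedProfile Z R U₀ x s) y = 0 := by
  have hw := divergence_newtonField (contDiff_cutoffDensity hZ hU) (cutoffDensity_eq_zero hZ hR) y s
  rw [← correction_eq_newtonField] at hw
  have hgrad : fderiv ℝ (rescaledCutoff Z R) y (U₀ y s) = cutoffDensity Z R U₀ y s := by
    simp [cutoffDensity, gradient]
  unfold divergence partialDeriv at *
  rw [← traceCLM_apply] at *
  rw [fderiv_revisedProfile hZ hR hU, map_add, map_add, map_smul, hdiv, hw, ← hgrad]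
  rw [traceCLM_apply]
  conv_lhs => enter [2, 1]; rw [← sum_basisVec (U₀ y s)]
  simp [mul_comm]

lemma revisedProfile_periodic {T : ℝ} (hper : ∀ y s, U₀ y (s + T) = U₀ y s) (y : E3) (s : ℝ) :
    revisedProfile Z R U₀ y (s + T) = revisedProfile Z R U₀ y s := by
  simp only [revisedProfile, correction, correctionIntegrand, hper]

lemma fderiv_rescaledCutoff_of_gt (hZ : IsCutoff Z) (hR : 0 < R) {z : E3} (hz : 2 * R < ‖z‖) :
    fderiv ℝ (rescaledCutoff Z R) z = 0 := by
  simpa [gradient] using gradient_rescaledCutoff_of_gt hZ hR hz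

/-- Decay of the terms by which `W` differs from `ξ U₀`, and of the commutator terms. -/
lemma exists_cutoff_bounds (hZ : IsCutoff Z) (hR : 0 < R)
    (hU : ContDiff ℝ 1 (Function.uncurry U₀)) (T : ℝ) :
    ∃ C : ℝ, 0 ≤ C ∧ ∀ s ∈ Set.Icc 0 T, ∀ y,
      (1 - rescaledCutoff Z R y) * ‖U₀ y s‖ ≤ C * decayWeight y ∧
      ‖fderiv ℝ (rescaledCutoff Z R) y‖ * ‖U₀ y s‖ ≤ C * decayWeight y ∧
      ‖fderiv ℝ (rescaledCutoff Z R) y‖ * ‖y‖ * ‖U₀ y s‖ ≤ C * decayWeight y ∧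
      ∀ i, ‖fderiv ℝ (rescaledCutoff Z R) y‖ * ‖partialDeriv i (fun x => U₀ x s) y‖ ≤
        C * decayWeight y := by
  have hξ := contDiff_rescaledCutoff hZ R
  have hDξ : Continuous (fderiv ℝ (rescaledCutoff Z R)) := hξ.continuous_fderiv (by simp)
  have hDU := hU.continuous_fderiv one_ne_zero
  have hU' : Continuous fun p : E3 × ℝ => U₀ p.1 p.2 := hU.continuous
  -- All four quantities are dominated by one continuous function vanishing for `‖y‖ > 2R`, so a
  -- single compactness argument suffices.
  set f : E3 → ℝ → ℝ := fun y s => (1 - rescaledCutoff Z R y) * ‖U₀ y s‖ +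
    ‖fderiv ℝ (rescaledCutoff Z R) y‖ * ((1 + ‖y‖) * ‖U₀ y s‖ +
      ‖fderiv ℝ (Function.uncurry U₀) (y, s)‖) with hfdef
  have hf : Continuous (Function.uncurry f) := by
    have h1 := hξ.continuous
    change Continuous fun p : E3 × ℝ => f p.1 p.2
    simp only [hfdef]
    fun_prop
  obtain ⟨C, hC, hb⟩ := exists_norm_le_decayWeight hf (r := 2 * R) (fun y s hy => by
    have : rescaledCutoff Z R y = 1 := hZ.eq_one _ (by
      rwa [norm_inv_smul hR, lt_div_iff₀ hR])
    simp [hfdef, this, fderiv_rescaledCutoff_of_gt hZ hR hy]) T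
  refine ⟨C, hC, fun s hs y => ?_⟩
  have h := (le_abs_self _).trans (hb s hs y)
  have hξ1 : 0 ≤ 1 - rescaledCutoff Z R y := sub_nonneg.2 (hZ.le_one _)
  have e1 : 0 ≤ (1 - rescaledCutoff Z R y) * ‖U₀ y s‖ := by positivity
  have e2 : 0 ≤ ‖fderiv ℝ (rescaledCutoff Z R) y‖ * ‖U₀ y s‖ := by positivity
  have e3 : 0 ≤ ‖fderiv ℝ (rescaledCutoff Z R) y‖ * ‖y‖ * ‖U₀ y s‖ := by positivity
  have e4 : 0 ≤ ‖fderiv ℝ (rescaledCutoff Z R) y‖ * ‖fderiv ℝ (Function.uncurry U₀) (y, s)‖ := by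
    positivity
  have hsplit : f y s = (1 - rescaledCutoff Z R y) * ‖U₀ y s‖ +
      ‖fderiv ℝ (rescaledCutoff Z R) y‖ * ‖U₀ y s‖ +
      ‖fderiv ℝ (rescaledCutoff Z R) y‖ * ‖y‖ * ‖U₀ y s‖ +
      ‖fderiv ℝ (rescaledCutoff Z R) y‖ * ‖fderiv ℝ (Function.uncurry U₀) (y, s)‖ := by
    simp only [hfdef]; ring
  rw [hsplit] at h
  refine ⟨by linarith, by linarith, by linarith, fun i => ?_⟩
  have := mul_le_mul_of_nonneg_left (norm_partialDeriv_slice_le hU i y s)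
    (norm_nonneg (fderiv ℝ (rescaledCutoff Z R) y))
  linarith

lemma exists_correction_bounds (hZ : IsCutoff Z) (hR : 0 < R)
    (hU : ContDiff ℝ 1 (Function.uncurry U₀)) (T : ℝ) :
    ∃ C : ℝ, 0 ≤ C ∧ ∀ s ∈ Set.Icc 0 T, ∀ y,
      ‖correction Z R U₀ y s‖ ≤ C * decayWeight y ∧
      ‖timeDeriv (correction Z R U₀) y s‖ ≤ C * decayWeight y ∧
      (∀ i, ‖partialDeriv i (fun x => correction Z R U₀ x s) y‖ ≤ C * decayWeight y) ∧
      ‖fderiv ℝ (fun x => correction Z R U₀ x s) y y‖ ≤ C * decayWeight y := by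
  rw [correction_eq_newtonField]
  exact exists_newtonField_bounds (by positivity) (contDiff_cutoffDensity hZ hU)
    (cutoffDensity_eq_zero hZ hR) T

/-- The difference is `(1 - ξ) U₀ - w`: one term vanishes far out, the other decays like the kernel.
It is used with `p = 2` for the energy class and with `p = 4`. -/
lemma exists_eLpNorm_sub_revisedProfile_le (hZ : IsCutoff Z) (hR : 0 < R)
    (hU : ContDiff ℝ 1 (Function.uncurry U₀)) (T : ℝ) {p : ℝ≥0∞} (hp : 3 / 2 < p) :
    ∃ C : ℝ≥0, ∀ s ∈ Set.Icc 0 T,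
      eLpNorm (fun y => U₀ y s - revisedProfile Z R U₀ y s) p volume ≤ C := by
  obtain ⟨C₁, hC₁, h₁⟩ := exists_cutoff_bounds hZ hR hU T
  obtain ⟨C₂, hC₂, h₂⟩ := exists_correction_bounds hZ hR hU T
  have hd := memLp_decayWeight hp
  refine ⟨(ENNReal.ofReal (C₁ + C₂) * eLpNorm decayWeight p volume).toNNReal, fun s hs => ?_⟩
  rw [ENNReal.coe_toNNReal (ENNReal.mul_ne_top ENNReal.ofReal_ne_top hd.2.ne)]
  refine eLpNorm_le_mul_eLpNorm_of_ae_le_mul (.of_forall fun y => ?_) p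
  have hξ1 : 0 ≤ 1 - rescaledCutoff Z R y := sub_nonneg.2 (hZ.le_one _)
  have e : U₀ y s - revisedProfile Z R U₀ y s =
      (1 - rescaledCutoff Z R y) • U₀ y s - correction Z R U₀ y s := by
    rw [revisedProfile, sub_smul, one_smul]; abel
  rw [e, Real.norm_of_nonneg (decayWeight_pos y).le]
  refine (norm_sub_le _ _).trans ?_
  rw [norm_smul, Real.norm_of_nonneg hξ1, add_mul]
  exact add_le_add (h₁ s hs y).1 (h₂ s hs y).1

lemma partialDeriv_smul {ξ : E3 → ℝ} {ζ : E3 → E3} {y : E3} (hξ : DifferentiableAt ℝ ξ y)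
    (hζ : DifferentiableAt ℝ ζ y) (i : Fin 3) :
    partialDeriv i (fun x => ξ x • ζ x) y =
      ξ y • partialDeriv i ζ y + fderiv ℝ ξ y (basisVec i) • ζ y := by
  have h := (hξ.hasFDerivAt.smul hζ.hasFDerivAt).fderiv
  rw [partialDeriv]
  exact (congrArg (fun A : E3 →L[ℝ] E3 => A (basisVec i)) h)

/-- Testing the equation of `U₀` with `ξζ` removes every term in which `ξ` is not differentiated, in
particular `ξ ∂ₛU₀` and `ξ y · ∇U₀`, which need not decay. -/
theorem exists_normHNegOne_revisedProfile_le (hZ : IsCutoff Z) (hR : 0 < R)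
    (hU : ContDiff ℝ 1 (Function.uncurry U₀)) (T : ℝ)
    (heq : ∀ s ζ, IsTestField ζ → pairingL U₀ s ζ = 0) :
    ∃ C : ℝ≥0, ∀ s ∈ Set.Icc 0 T, normHNegOne (pairingL (revisedProfile Z R U₀) s) ≤ C := by
  obtain ⟨C₁, hC₁, h₁⟩ := exists_cutoff_bounds hZ hR hU T
  obtain ⟨C₂, hC₂, h₂⟩ := exists_correction_bounds hZ hR hU T
  have hξ : ContDiff ℝ 1 (rescaledCutoff Z R) := (contDiff_rescaledCutoff hZ R).of_le (by norm_cast)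
  -- In the lower-order part, `C₁` bounds the commutator `(y · ∇ξ) U₀` and `3 C₂` the terms `∂ₛw`,
  -- `w`, `y · ∇w`. The gradient part needs only `C₁ + C₂`.
  refine ⟨((C₁ + 3 * C₂) * (7 * (∫ y, decayWeight y ^ 2) + 4)).toNNReal, fun s hs => ?_⟩
  refine iSup₂_le fun ζ hζ => ENNReal.ofReal_le_ofReal ?_
  obtain ⟨hζ, hζ1⟩ := hζ
  set W := revisedProfile Z R U₀ with hWdef
  set ξ := rescaledCutoff Z R with hξdef
  set w := correction Z R U₀ with hwdef
  have hW : ContDiff ℝ 1 (Function.uncurry W) := contDiff_revisedProfile hZ hR hU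
  have hξζ : IsTestField fun y => ξ y • ζ y :=
    ⟨hξ.smul hζ.1, hζ.2.mono fun y hy h => hy (by simp [h])⟩
  have hsub : pairingL W s ζ = (∫ y, ((inner ℝ (timeDeriv W y s - W y s -
        fderiv ℝ (fun x => W x s) y y) (ζ y) : ℝ) - inner ℝ (timeDeriv U₀ y s - U₀ y s -
        fderiv ℝ (fun x => U₀ x s) y y) (ξ y • ζ y))) +
      ∫ y, ((∑ i : Fin 3, (inner ℝ (partialDeriv i (fun x => W x s) y) (partialDeriv i ζ y) : ℝ)) -
        ∑ i : Fin 3, inner ℝ (partialDeriv i (fun x => U₀ x s) y)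
          (partialDeriv i (fun x => ξ x • ζ x) y)) := by
    rw [integral_sub (integrable_pairing_lower hW s hζ) (integrable_pairing_lower hU s hξζ),
      integral_sub (integrable_pairing_gradient hW s hζ) (integrable_pairing_gradient hU s hξζ)]
    have h0 := heq s _ hξζ
    rw [pairingL] at h0 ⊢
    linarith
  rw [hsub]
  refine abs_le_of_norm_le_decayWeight (by positivity) hζ hζ1 (fun y => ?_) fun y => ?_
  · obtain ⟨-, -, hb, -⟩ := h₁ s hs y
    obtain ⟨hw0, hwt, -, hwr⟩ := h₂ s hs y
    have e : (inner ℝ (timeDeriv W y s - W y s - fderiv ℝ (fun x => W x s) y y) (ζ y) : ℝ) -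
        inner ℝ (timeDeriv U₀ y s - U₀ y s - fderiv ℝ (fun x => U₀ x s) y y) (ξ y • ζ y) =
        inner ℝ (timeDeriv w y s - w y s - fderiv ℝ (fun x => w x s) y y -
          fderiv ℝ ξ y y • U₀ y s) (ζ y) := by
      rw [real_inner_smul_right, ← real_inner_smul_left, ← inner_sub_left]
      congr 1
      rw [timeDeriv_revisedProfile hZ hR hU, fderiv_revisedProfile hZ hR hU]
      simp only [hWdef, revisedProfile, add_apply,
        smul_apply, ContinuousLinearMap.smulRight_apply, smul_sub]
      abel
    rw [e]
    refine (norm_inner_le_norm _ _).trans (mul_le_mul_of_nonneg_right ?_ (norm_nonneg _))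
    have h3 : ‖fderiv ℝ ξ y y • U₀ y s‖ ≤ C₁ * decayWeight y := by
      rw [norm_smul]
      exact (mul_le_mul_of_nonneg_right (ContinuousLinearMap.le_opNorm _ _)
        (norm_nonneg _)).trans hb
    have h4 := norm_sub_le (timeDeriv w y s - w y s - fderiv ℝ (fun x => w x s) y y)
      (fderiv ℝ ξ y y • U₀ y s)
    have h5 := norm_sub_le (timeDeriv w y s - w y s) (fderiv ℝ (fun x => w x s) y y)
    have h6 := norm_sub_le (timeDeriv w y s) (w y s)
    linarith
  · obtain ⟨-, hb, -, hbi⟩ := h₁ s hs y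
    obtain ⟨-, -, hwi, -⟩ := h₂ s hs y
    have hd := decayWeight_pos y
    rw [← Finset.sum_sub_distrib]
    refine (norm_sum_le _ _).trans (Finset.sum_le_sum fun i _ => ?_)
    have hDξ : ‖fderiv ℝ ξ y (basisVec i)‖ ≤ ‖fderiv ℝ ξ y‖ := by
      simpa [norm_basisVec] using (fderiv ℝ ξ y).le_opNorm (basisVec i)
    have hWi : partialDeriv i (fun x => W x s) y = ξ y • partialDeriv i (fun x => U₀ x s) y +
        fderiv ℝ ξ y (basisVec i) • U₀ y s + partialDeriv i (fun x => w x s) y := by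
      rw [partialDeriv, fderiv_revisedProfile hZ hR hU]
      rfl
    -- Both products generate a commutator: `∂ᵢξ U₀` against `∂ᵢζ` from `W`, and `∂ᵢξ ∂ᵢU₀` against
    -- `ζ` from the test field `ξζ`.
    have e : (inner ℝ (partialDeriv i (fun x => W x s) y) (partialDeriv i ζ y) : ℝ) -
        inner ℝ (partialDeriv i (fun x => U₀ x s) y) (partialDeriv i (fun x => ξ x • ζ x) y) =
        inner ℝ (fderiv ℝ ξ y (basisVec i) • U₀ y s + partialDeriv i (fun x => w x s) y)
          (partialDeriv i ζ y) -
        inner ℝ (fderiv ℝ ξ y (basisVec i) • partialDeriv i (fun x => U₀ x s) y) (ζ y) := by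
      rw [partialDeriv_smul (hξ.differentiable one_ne_zero y) (hζ.1.differentiable one_ne_zero y),
        hWi]
      simp only [inner_add_left, inner_add_right, real_inner_smul_left, real_inner_smul_right]
      ring
    rw [e]
    have h3 : ‖fderiv ℝ ξ y (basisVec i) • U₀ y s‖ ≤ C₁ * decayWeight y := by
      rw [norm_smul]
      exact (mul_le_mul_of_nonneg_right hDξ (norm_nonneg _)).trans hb
    have h4 : ‖fderiv ℝ ξ y (basisVec i) • partialDeriv i (fun x => U₀ x s) y‖ ≤
        C₁ * decayWeight y := by
      rw [norm_smul]
      exact (mul_le_mul_of_nonneg_right hDξ (norm_nonneg _)).trans (hbi i)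
    have h5 : 0 ≤ C₂ * decayWeight y := by positivity
    rw [mul_add]
    refine (norm_sub_le _ _).trans (add_le_add ?_ ?_)
    · refine (norm_inner_le_norm _ _).trans (mul_le_mul_of_nonneg_right ?_ (norm_nonneg _))
      refine (norm_add_le _ _).trans ?_
      linarith [hwi i]
    · refine (norm_inner_le_norm _ _).trans (mul_le_mul_of_nonneg_right ?_ (norm_nonneg _))
      linarith

/-- `ξ` vanishes in `B_R` and is at most `1`, so `ξ U₀` costs the constant `1`; the correction obeys
the scale-invariant bound. -/
lemma eLpNorm_revisedProfile_le (hZ : IsCutoff Z) {q : ℝ≥0∞} (hq : 3 < q) :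
    ∃ C : ℝ≥0, ∀ R : ℝ, 0 < R → ∀ U : E3 → ℝ → E3, ContDiff ℝ 1 (Function.uncurry U) → ∀ s,
      eLpNorm (fun y => revisedProfile Z R U y s) q volume ≤
        C * eLpNorm (fun y => U y s) q (volume.restrict (Metric.ball (0 : E3) R)ᶜ) := by
  obtain ⟨C, hC⟩ := exists_eLpNorm_correction_le hZ hq
  refine ⟨1 + C, fun R hR U hU s => ?_⟩
  have hUs := (contDiff_slice hU s).continuous
  have hξU : Continuous fun y => rescaledCutoff Z R y • U y s :=
    (contDiff_rescaledCutoff hZ R).continuous.smul hUs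
  have hws := (contDiff_slice (contDiff_correction hZ hR hU) s).continuous
  refine (eLpNorm_add_le hξU.aestronglyMeasurable hws.aestronglyMeasurable
    (le_trans (by norm_num) hq.le)).trans ?_
  push_cast
  rw [add_mul, one_mul]
  refine add_le_add ?_ (hC R hR U s hUs)
  rw [← eLpNorm_indicator_eq_eLpNorm_restrict Metric.isOpen_ball.measurableSet.compl]
  refine eLpNorm_mono fun y => ?_
  by_cases hy : y ∈ (Metric.ball (0 : E3) R)ᶜ
  · rw [Set.indicator_of_mem hy, norm_smul, rescaledCutoff, Real.norm_of_nonneg (hZ.nonneg _)]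
    exact mul_le_of_le_one_left (norm_nonneg _) (hZ.le_one _)
  · have : rescaledCutoff Z R y = 0 := hZ.eq_zero _ (by
      rw [norm_inv_smul hR, div_lt_one hR]; simpa using hy)
    simp [this]

lemma linftyLpNorm_revisedProfile_four_lt_top (hZ : IsCutoff Z) (hR : 0 < R) {T : ℝ}
    (hU : ContDiff ℝ 1 (Function.uncurry U₀)) (h4 : linftyLpNorm U₀ 4 T volume < ⊤) :
    linftyLpNorm (revisedProfile Z R U₀) 4 T volume < ⊤ := by
  obtain ⟨C, hC⟩ := exists_eLpNorm_sub_revisedProfile_le hZ hR hU T (p := 4) (by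
    rw [ENNReal.div_lt_iff (by simp) (by simp)]; norm_num)
  refine lt_of_le_of_lt (linftyLpNorm_le (C := linftyLpNorm U₀ 4 T volume + C) ?_)
    (ENNReal.add_lt_top.2 ⟨h4, ENNReal.coe_lt_top⟩)
  filter_upwards [ENNReal.ae_le_essSup
    (μ := volume.restrict (Set.Ioo 0 T)) fun s => eLpNorm (fun y => U₀ y s) 4 volume,
    ae_restrict_mem measurableSet_Ioo] with s hs hsT
  have hUs := (contDiff_slice hU s).continuous
  have hWs := (contDiff_slice (contDiff_revisedProfile hZ hR hU) s).continuous
  have e : (fun y => revisedProfile Z R U₀ y s) =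
      (fun y => U₀ y s) - fun y => U₀ y s - revisedProfile Z R U₀ y s := by
    ext1 y; simp
  rw [e]
  exact (eLpNorm_sub_le hUs.aestronglyMeasurable (hUs.sub hWs).aestronglyMeasurable
    (by norm_num)).trans (add_le_add hs (hC s (Set.Ioo_subset_Icc_self hsT)))

lemma linftyHNegOneNormL_revisedProfile_lt_top (hZ : IsCutoff Z) (hR : 0 < R) (T : ℝ)
    (hU : ContDiff ℝ 1 (Function.uncurry U₀))
    (heq : ∀ s ζ, IsTestField ζ → pairingL U₀ s ζ = 0) :
    linftyHNegOneNormL (revisedProfile Z R U₀) T < ⊤ := by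
  obtain ⟨C, hC⟩ := exists_normHNegOne_revisedProfile_le hZ hR hU T heq
  refine lt_of_le_of_lt (essSup_le_of_ae_le (C : ℝ≥0∞) ?_) ENNReal.coe_lt_top
  filter_upwards [ae_restrict_mem measurableSet_Ioo] with s hs
  exact hC s (Set.Ioo_subset_Icc_self hs)

lemma memLinftyLp_sub_revisedProfile (hZ : IsCutoff Z) (hR : 0 < R) (T : ℝ)
    (hU : ContDiff ℝ 1 (Function.uncurry U₀)) :
    MemLinftyLp (fun y s => U₀ y s - revisedProfile Z R U₀ y s) 2 T volume := by
  obtain ⟨C, hC⟩ := exists_eLpNorm_sub_revisedProfile_le hZ hR hU T (p := 2) (by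
    rw [ENNReal.div_lt_iff (by simp) (by simp)]; norm_num)
  refine ⟨(hU.continuous.sub (contDiff_revisedProfile hZ hR hU).continuous).aestronglyMeasurable,
    lt_of_le_of_lt (linftyLpNorm_le ?_) (ENNReal.coe_lt_top (r := C))⟩
  filter_upwards [ae_restrict_mem measurableSet_Ioo] with s hs
  exact hC s (Set.Ioo_subset_Icc_self hs)

end

end Leray

/-! ### Choice of `c` and of the radius -/

theorem lemma2 (q : ℝ≥0∞) (hq : 3 < q) (T : ℝ) (U₀ : Leray.E3 → ℝ → Leray.E3)
    (hU₀ : Leray.IsProfile T q U₀) (Z : Leray.E3 → ℝ) (hZ : Leray.IsCutoff Z) :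
    ∃ c : ℝ → ℝ≥0, ∀ α ∈ Set.Ioo (0 : ℝ) 1, ∃ R₀ : ℝ, 1 ≤ R₀ ∧
      (∀ y s, Integrable (Leray.correctionIntegrand Z R₀ U₀ y s)) ∧
      ContDiff ℝ 1 (Function.uncurry (Leray.revisedProfile Z R₀ U₀)) ∧
      (∀ y s, Leray.revisedProfile Z R₀ U₀ y (s + T) = Leray.revisedProfile Z R₀ U₀ y s) ∧
      (∀ y s, Leray.divergence (fun x => Leray.revisedProfile Z R₀ U₀ x s) y = 0) ∧
      Leray.MemLinftyLp (fun y s => U₀ y s - Leray.revisedProfile Z R₀ U₀ y s) 2 T volume ∧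
      Leray.linftyLpNorm (Leray.revisedProfile Z R₀ U₀) q T volume ≤ ENNReal.ofReal α ∧
      Leray.linftyLpNorm (Leray.revisedProfile Z R₀ U₀) 4 T volume ≤ c R₀ ∧
      Leray.linftyHNegOneNormL (Leray.revisedProfile Z R₀ U₀) T ≤ c R₀ := by
  have hU := hU₀.contDiff
  obtain ⟨C, hC⟩ := Leray.eLpNorm_revisedProfile_le hZ hq
  obtain ⟨Θ, hΘ, hdecay⟩ := hU₀.decay
  -- `c R` is the sum of the two norms to be bounded, which depends on `R` but not on `α`. The
  -- content is its finiteness for every `R > 0`, so that `toNNReal` loses nothing.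
  refine ⟨fun R => (Leray.linftyLpNorm (Leray.revisedProfile Z R U₀) 4 T volume +
    Leray.linftyHNegOneNormL (Leray.revisedProfile Z R U₀) T).toNNReal, fun α hα => ?_⟩
  have hlim : Tendsto (fun R => C * Θ R) atTop (𝓝 0) := by
    simpa using hΘ.const_mul C
  obtain ⟨R, hRα, hR1⟩ := ((hlim.eventually
    (gt_mem_nhds (Real.toNNReal_pos.2 hα.1))).and (eventually_ge_atTop 1)).exists
  have hR1' : (1 : ℝ) ≤ R := by exact_mod_cast hR1
  have hR : (0 : ℝ) < R := by linarith
  have h4 := Leray.linftyLpNorm_revisedProfile_four_lt_top hZ hR hU hU₀.memL4.2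
  have hH := Leray.linftyHNegOneNormL_revisedProfile_lt_top hZ hR T hU hU₀.equation
  refine ⟨R, hR1', fun y s => Leray.integrable_correctionIntegrand hZ hR hU y s,
    Leray.contDiff_revisedProfile hZ hR hU, Leray.revisedProfile_periodic hU₀.periodic,
    fun y s => Leray.divergence_revisedProfile hZ hR hU (hU₀.divFree y s),
    Leray.memLinftyLp_sub_revisedProfile hZ hR T hU, Leray.linftyLpNorm_le ?_, ?_, ?_⟩
  · filter_upwards [ae_restrict_mem measurableSet_Ioo] with s hs
    refine (hC R hR U₀ hU s).trans ((mul_le_mul_right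
      (hdecay R s (Set.Ioo_subset_Icc_self hs)) _).trans ?_)
    rw [← ENNReal.coe_mul]
    exact ENNReal.coe_le_coe.2 hRα.le
  · rw [ENNReal.coe_toNNReal (ENNReal.add_lt_top.2 ⟨h4, hH⟩).ne]
    exact le_self_add
  · rw [ENNReal.coe_toNNReal (ENNReal.add_lt_top.2 ⟨h4, hH⟩).ne]
    exact le_add_self
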